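/- Let ${\bf k}$ be a field of prime characteristic $p$, let $G$ be a group with a finite normal subgroup $H$ such that $p\nmid |H|$ and $G/H\cong C_q$ is cyclic of order $q$, where $q$ is a power of $p$, and let $\rho$ be a generator of $C_q=G/H$; put $\Delta_\rho=1-\rho$, acting on the $H$-invariants of any ${\bf k}G$-module. Let $A$ be a unital ${\bf k}$-algebra on which $G$ acts by ${\bf k}$-algebra automorphisms, and let $M$ be an $A^eG$-module algebra, i.e. an $A$-bimodule (with ${\bf k}$ acting centrally) that is also a unital ${\bf k}$-algebra, such that the multiplication of $M$ is an $A$-bimodule map $M\otimes_A M\to M$, and $G$ acts on $M$ by ${\bf k}$-algebra automorphisms with ${}^{\alpha}(axb)={}^{\alpha}a\,{}^{\alpha}x\,{}^{\alpha}b$ for $\alpha\in G$, $a,b\in A$, $x\in M$. Let $C(A,M)$ be the Hochschild cochain complex, $C^n(A,M)={\rm Hom}_{\bf k}(A^{\otimes n},M)$, with the cup product $\smile$ and the $G$-action $({}^{\alpha}f)(x)=\alpha\big(f(\alpha^{-1}x)\big)$. Let ${\rm HH}^*(A,M)$ be its cohomology, with the induced $G$-action and product, let ${\rm HH}^*(A,M)^{G\uparrow}$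 be the cohomology of the subcomplex $C(A,M)^G$, and let $\Theta_M^G:{\rm HH}^*(A,M)^{G\uparrow}\to {\rm HH}^*(A,M)^G$ be the homomorphism of graded algebras induced by the inclusion $C(A,M)^G\subset C(A,M)$. Put $$\mathcal A_M^G={\rm Im}\,\Theta_M^G,\qquad X_M^G={\rm Ker}\,\Theta_M^G,\qquad Y_M^G={\rm HH}^*(A,M)^G/{\rm Im}\,\Theta_M^G .$$ Assume that $M$ is $({\bf m},{\bf h})$-degenerated: ${\bf m}\in M^H$ and ${\bf h}\in{\rm Der}(A,M)^H$ satisfy $\Delta_\rho^{q-1}{\bf m}=1_M$ and $\Delta_\rho{\bf h}+\phi_{\bf m}=0$, where $\phi_{\bf m}(a)=a{\bf m}-{\bf m}a$ for $a\in A$. Then the product of any two elements of the ideal $X_M^G$ of ${\rm HH}^*(A,M)^{G\uparrow}$ is zero, so that $X_M^G$ is a graded $\mathcal A_M^G$-bimodule by $\Theta_M^G(b)x=b\smile x$ and $x\,\Theta_M^G(b)=x\smile b$; also $Y_M^G$ is a graded $\mathcal A_M^G$-bimodule by the product of ${\rm HH}^*(A,M)^G$. There are two filtrations by graded $\mathcal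 A_M^G$-subbimodules $$0=X_{q-1}\subset X_{q-2}\subset\cdots\subset X_1\subset X_0=X_M^G,\qquad 0=Y_{q-1}\subset Y_{q-2}\subset\cdots\subset Y_1\subset Y_0=Y_M^G$$ (inclusions not necessarily strict) such that $Y_i/Y_{i+1}\cong X_{q-2-i}/X_{q-1-i}$ as graded $\mathcal A_M^G$-bimodules for $0\le i\le q-2$. Moreover, if $\Delta_\rho^i\,{\rm HH}^*(A,M)^H={\rm HH}^*(A,M)^G$ for some $0\le i\le q-1$, then $X_{q-1-i}=0=Y_{i+1}$, $X_{q-2-i}=X_M^G$, $Y_i=Y_M^G$, and $X_M^G\cong Y_M^G$ as graded $\mathcal A_M^G$-bimodules (for $i=q-1$ one reads $X_{-1}=X_M^G$ and $Y_q=0$). -/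

import Mathlib

/-!  Hochschild cohomology with a group action: cochains, differential, cup product, the
invariant subcomplex, the comparison map `Θ`, and graded bimodules. -/

namespace HochG

open MulOpposite

/-- `M` is an `A^eG`-module algebra.  The type class arguments say that `A` and `M` are unital
`k`-algebras on which `G` acts by `k`-algebra automorphisms and that `M` is an `A`-bimodule (the right
action of `a` is `op a • x`).  The fields say that the multiplication of `M` is an `A`-bimodule map
`M ⊗_A M → M`, and that `G` acts compatibly on `A` and on the bimodule `M`. -/
class IsAeGModuleAlgebra (k A M G : Type*) [Field k] [Ring A] [Algebra k A] [Ring M] [Algebra k M]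
    [Module A M] [Module Aᵐᵒᵖ M] [SMulCommClass A Aᵐᵒᵖ M]
    [IsScalarTower k A M] [IsScalarTower k Aᵐᵒᵖ M]
    [Group G] [MulSemiringAction G A] [SMulCommClass G k A]
    [MulSemiringAction G M] [SMulCommClass G k M] : Prop where
  smul_mul : ∀ (a : A) (x y : M), (a • x) * y = a • (x * y)
  mul_op_smul : ∀ (a : A) (x y : M), x * (op a • y) = op a • (x * y)
  op_smul_mul : ∀ (a : A) (x y : M), (op a • x) * y = x * (a • y)
  group_smul : ∀ (g : G) (a : A) (x : M), g • (a • x) = (g • a) • (g • x)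
  group_op_smul : ∀ (g : G) (a : A) (x : M), g • (op a • x) = op (g • a) • (g • x)

/-! ### Subquotients of modules -/

section Subquot

variable {k : Type*} [Field k]

/-- The quotient `P / (P' ∩ P)`; it is only used for `P' ≤ P`, where it is `P / P'`. -/
def Subquot {V : Type*} [AddCommGroup V] [Module k V] (P P' : Submodule k V) : Type _ :=
  P ⧸ P'.submoduleOf P

instance {V : Type*} [AddCommGroup V] [Module k V] (P P' : Submodule k V) :
    AddCommGroup (Subquot P P') :=
  inferInstanceAs (AddCommGroup (P ⧸ P'.submoduleOf P))

instance {V : Type*} [AddCommGroup V] [Module k V] (P P' : Submodule k V) :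
    Module k (Subquot P P') :=
  inferInstanceAs (Module k (P ⧸ P'.submoduleOf P))

/-- The class of an element of `P`. -/
def Subquot.mk {V : Type*} [AddCommGroup V] [Module k V] (P P' : Submodule k V) :
    P →ₗ[k] Subquot P P' := (P'.submoduleOf P).mkQ

/-- A linear map of subquotients induced by a linear map. -/
def Subquot.map {V W : Type*} [AddCommGroup V] [Module k V] [AddCommGroup W] [Module k W]
    (φ : V →ₗ[k] W) (P P' : Submodule k V) (Q Q' : Submodule k W)
    (h : ∀ v ∈ P, φ v ∈ Q) (h' : ∀ v ∈ P, v ∈ P' → φ v ∈ Q') :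
    Subquot P P' →ₗ[k] Subquot Q Q' :=
  Submodule.mapQ (P'.submoduleOf P) (Q'.submoduleOf Q) (φ.restrict h) (fun v hv => h' v.1 v.2 hv)

theorem Subquot.mk_surjective {V : Type*} [AddCommGroup V] [Module k V] (P P' : Submodule k V) :
    Function.Surjective (Subquot.mk P P') := Submodule.mkQ_surjective _

theorem Subquot.mk_eq_zero {V : Type*} [AddCommGroup V] [Module k V] {P P' : Submodule k V}
    (v : P) : Subquot.mk P P' v = 0 ↔ (v : V) ∈ P' := Submodule.Quotient.mk_eq_zero _

theorem Subquot.map_mk {V W : Type*} [AddCommGroup V] [Module k V] [AddCommGroup W] [Module k W]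
    (φ : V →ₗ[k] W) (P P' : Submodule k V) (Q Q' : Submodule k W)
    (h : ∀ v ∈ P, φ v ∈ Q) (h' : ∀ v ∈ P, v ∈ P' → φ v ∈ Q') (v : P) :
    Subquot.map φ P P' Q Q' h h' (Subquot.mk P P' v) = Subquot.mk Q Q' ⟨φ v, h v v.2⟩ := rfl

/-- A bilinear map `U × (Q / Q') → T / T'` induced by a bilinear map. -/
def Subquot.mapRight {U V W : Type*} [AddCommGroup U] [Module k U] [AddCommGroup V] [Module k V]
    [AddCommGroup W] [Module k W] (β : U →ₗ[k] V →ₗ[k] W)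
    (Q Q' : Submodule k V) (T T' : Submodule k W)
    (h : ∀ u, ∀ v ∈ Q, β u v ∈ T) (h' : ∀ u, ∀ v ∈ Q, v ∈ Q' → β u v ∈ T') :
    U →ₗ[k] Subquot Q Q' →ₗ[k] Subquot T T' where
  toFun u := Subquot.map (β u) Q Q' T T' (h u) (h' u)
  map_add' u u' := by
    refine LinearMap.ext fun x => ?_
    obtain ⟨v, rfl⟩ := Subquot.mk_surjective _ _ x
    rw [LinearMap.add_apply, Subquot.map_mk, Subquot.map_mk, Subquot.map_mk, ← map_add]
    congr 1
    ext
    simp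
  map_smul' c u := by
    refine LinearMap.ext fun x => ?_
    obtain ⟨v, rfl⟩ := Subquot.mk_surjective _ _ x
    rw [RingHom.id_apply, LinearMap.smul_apply, Subquot.map_mk, Subquot.map_mk, ← map_smul]
    congr 1
    ext
    simp

/-- A bilinear map `(P / P') × (Q / Q') → T / T'` induced by a bilinear map. -/
def Subquot.map₂ {U V W : Type*} [AddCommGroup U] [Module k U] [AddCommGroup V] [Module k V]
    [AddCommGroup W] [Module k W] (β : U →ₗ[k] V →ₗ[k] W)
    (P P' : Submodule k U) (Q Q' : Submodule k V) (T T' : Submodule k W)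
    (h : ∀ u ∈ P, ∀ v ∈ Q, β u v ∈ T)
    (hl : ∀ u ∈ P, u ∈ P' → ∀ v ∈ Q, β u v ∈ T')
    (hr : ∀ u ∈ P, ∀ v ∈ Q, v ∈ Q' → β u v ∈ T') :
    Subquot P P' →ₗ[k] Subquot Q Q' →ₗ[k] Subquot T T' :=
  (P'.submoduleOf P).liftQ
    (Subquot.mapRight (β.comp P.subtype) Q Q' T T' (fun u => h u.1 u.2) (fun u => hr u.1 u.2))
    (by
      intro u hu
      rw [LinearMap.mem_ker]
      refine LinearMap.ext fun x => ?_
      obtain ⟨v, rfl⟩ := Subquot.mk_surjective _ _ x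
      exact (Subquot.mk_eq_zero _).2 (hl u.1 u.2 hu v.1 v.2))

theorem Subquot.map₂_mk {U V W : Type*} [AddCommGroup U] [Module k U] [AddCommGroup V] [Module k V]
    [AddCommGroup W] [Module k W] (β : U →ₗ[k] V →ₗ[k] W)
    (P P' : Submodule k U) (Q Q' : Submodule k V) (T T' : Submodule k W)
    (h : ∀ u ∈ P, ∀ v ∈ Q, β u v ∈ T)
    (hl : ∀ u ∈ P, u ∈ P' → ∀ v ∈ Q, β u v ∈ T')
    (hr : ∀ u ∈ P, ∀ v ∈ Q, v ∈ Q' → β u v ∈ T') (u : P) (v : Q) :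
    Subquot.map₂ β P P' Q Q' T T' h hl hr (Subquot.mk P P' u) (Subquot.mk Q Q' v) =
      Subquot.mk T T' ⟨β u v, h u u.2 v v.2⟩ := rfl

end Subquot

/-! ### Cochains -/

section Cochains

variable (k A M : Type*) [Field k] [Ring A] [Algebra k A] [Ring M] [Algebra k M]

/-- `C^n(A, M) = Hom_k(A^{⊗ n}, M)`. -/
abbrev Cochain (n : ℕ) : Type _ := MultilinearMap k (fun _ : Fin n => A) M

variable {k A M}

theorem contractNth_update {n : ℕ} (i : Fin n) (a : Fin (n + 1) → A) (j : Fin (n + 1)) :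
    ∃ (l : Fin n) (φ : A →ₗ[k] A), ∀ x, Fin.contractNth i.castSucc (· * ·) (Function.update a j x) =
      Function.update (Fin.contractNth i.castSucc (· * ·) a) l (φ x) := by
  have key : ∀ (l : Fin n) (φ : A →ₗ[k] A),
      (∀ x, Fin.contractNth i.castSucc (· * ·) (Function.update a j x) l = φ x) →
      (∀ l', l' ≠ l → ∀ x, Fin.contractNth i.castSucc (· * ·) (Function.update a j x) l' =
        Fin.contractNth i.castSucc (· * ·) a l') →
      ∀ x, Fin.contractNth i.castSucc (· * ·) (Function.update a j x) =
      Function.update (Fin.contractNth i.castSucc (· * ·) a) l (φ x) := by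
    intro l φ h1 h2 x
    funext l'
    by_cases h : l' = l
    · subst h; simp [h1]
    · simp [h, h2 l' h]
  rcases lt_trichotomy j.val i.val with hj | hj | hj
  · refine ⟨⟨j.val, by omega⟩, LinearMap.id, key _ _ ?_ ?_⟩
    · intro x
      have : (Fin.castSucc ⟨j.val, by omega⟩ : Fin (n + 1)) = j := by ext; simp
      simp [Fin.contractNth, hj, this]
    · intro l' hl' x
      simp only [Fin.contractNth, Function.update_apply, Fin.ext_iff, Fin.val_castSucc,
        Fin.val_succ, ne_eq] at *
      split_ifs <;> first | rfl | omega
  · refine ⟨i, LinearMap.mulRight k (a i.succ), key _ _ ?_ ?_⟩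
    · intro x
      simp only [Fin.contractNth, Function.update_apply, Fin.ext_iff, Fin.val_castSucc,
        Fin.val_succ, LinearMap.mulRight_apply]
      split_ifs <;> first | rfl | omega
    · intro l' hl' x
      simp only [Fin.contractNth, Function.update_apply, Fin.ext_iff, Fin.val_castSucc,
        Fin.val_succ, ne_eq] at *
      split_ifs <;> first | rfl | omega
  · by_cases hj' : j.val = i.val + 1
    · refine ⟨i, LinearMap.mulLeft k (a i.castSucc), key _ _ ?_ ?_⟩
      · intro x
        simp only [Fin.contractNth, Function.update_apply, Fin.ext_iff, Fin.val_castSucc,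
          Fin.val_succ, LinearMap.mulLeft_apply]
        split_ifs <;> first | rfl | omega
      · intro l' hl' x
        simp only [Fin.contractNth, Function.update_apply, Fin.ext_iff, Fin.val_castSucc,
          Fin.val_succ, ne_eq] at *
        split_ifs <;> first | rfl | omega
    · refine ⟨⟨j.val - 1, by omega⟩, LinearMap.id, key _ _ ?_ ?_⟩
      · intro x
        simp only [Fin.contractNth, Function.update_apply, Fin.ext_iff, Fin.val_castSucc,
          Fin.val_succ, LinearMap.id_apply]
        split_ifs <;> first | rfl | omega
      · intro l' hl' x
        simp only [Fin.contractNth, Function.update_apply, Fin.ext_iff, Fin.val_castSucc,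
          Fin.val_succ, ne_eq] at *
        split_ifs <;> first | rfl | omega

/-- The cochain `a ↦ f (a₀, …, a_i a_{i+1}, …, a_n)` (indices start at `0`). -/
def contractTerm {n : ℕ} (i : Fin n) : Cochain k A M n →ₗ[k] Cochain k A M (n + 1) where
  toFun f :=
    { toFun := fun a => f (Fin.contractNth i.castSucc (· * ·) a)
      map_update_add' := by
        intro inst a j x y
        obtain rfl : inst = instDecidableEqFin _ := Subsingleton.elim _ _
        obtain ⟨l, φ, h⟩ := contractNth_update (k := k) i a j
        simp [h]
      map_update_smul' := by
        intro inst a j c x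
        obtain rfl : inst = instDecidableEqFin _ := Subsingleton.elim _ _
        obtain ⟨l, φ, h⟩ := contractNth_update (k := k) i a j
        simp [h] }
  map_add' _ _ := rfl
  map_smul' _ _ := rfl

section Bimodule

variable [Module A M] [Module Aᵐᵒᵖ M] [IsScalarTower k A M] [IsScalarTower k Aᵐᵒᵖ M]

/-- The cochain `a ↦ a₀ f (a₁, …, a_n)`. -/
def leftTerm (n : ℕ) : Cochain k A M n →ₗ[k] Cochain k A M (n + 1) where
  toFun f :=
    { toFun := fun a => a 0 • f (fun i => a i.succ)
      map_update_add' := by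
        intro inst a j x y
        obtain rfl : inst = instDecidableEqFin _ := Subsingleton.elim _ _
        refine Fin.cases ?_ (fun j => ?_) j
        · simp [add_smul]
        · have h : ∀ z, (fun i : Fin n => Function.update a j.succ z i.succ) =
              Function.update (fun i : Fin n => a i.succ) j z := by
            intro z; funext i; simp [Function.update_apply]
          have h0 : ∀ z, Function.update a j.succ z 0 = a 0 := fun z =>
            Function.update_of_ne (Fin.succ_ne_zero j).symm _ _
          simp [h, h0, smul_add]
      map_update_smul' := by
        intro inst a j c x
        obtain rfl : inst = instDecidableEqFin _ := Subsingleton.elim _ _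
        refine Fin.cases ?_ (fun j => ?_) j
        · simp
        · have h : ∀ z, (fun i : Fin n => Function.update a j.succ z i.succ) =
              Function.update (fun i : Fin n => a i.succ) j z := by
            intro z; funext i; simp [Function.update_apply]
          have h0 : ∀ z, Function.update a j.succ z 0 = a 0 := fun z =>
            Function.update_of_ne (Fin.succ_ne_zero j).symm _ _
          simp [h, h0, smul_comm c (a 0)] }
  map_add' f g := by ext a; simp
  map_smul' c f := by ext a; simp [smul_comm c (a 0)]

/-- The cochain `a ↦ f (a₀, …, a_{n-1}) a_n`. -/
def rightTerm (n : ℕ) : Cochain k A M n →ₗ[k] Cochain k A M (n + 1) where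
  toFun f :=
    { toFun := fun a => op (a (Fin.last n)) • f (fun i => a i.castSucc)
      map_update_add' := by
        intro inst a j x y
        obtain rfl : inst = instDecidableEqFin _ := Subsingleton.elim _ _
        refine Fin.lastCases ?_ (fun j => ?_) j
        · simp [add_smul]
        · have h : ∀ z, (fun i : Fin n => Function.update a j.castSucc z i.castSucc) =
              Function.update (fun i : Fin n => a i.castSucc) j z := by
            intro z; funext i; simp [Function.update_apply]
          have h0 : ∀ z, Function.update a j.castSucc z (Fin.last n) = a (Fin.last n) := fun z =>
            Function.update_of_ne (Fin.castSucc_ne_last j).symm _ _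
          simp [h, h0, smul_add]
      map_update_smul' := by
        intro inst a j c x
        obtain rfl : inst = instDecidableEqFin _ := Subsingleton.elim _ _
        refine Fin.lastCases ?_ (fun j => ?_) j
        · simp
        · have h : ∀ z, (fun i : Fin n => Function.update a j.castSucc z i.castSucc) =
              Function.update (fun i : Fin n => a i.castSucc) j z := by
            intro z; funext i; simp [Function.update_apply]
          have h0 : ∀ z, Function.update a j.castSucc z (Fin.last n) = a (Fin.last n) := fun z =>
            Function.update_of_ne (Fin.castSucc_ne_last j).symm _ _
          simp [h, h0, smul_comm c (op (a (Fin.last n)))] }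
  map_add' f g := by ext a; simp
  map_smul' c f := by ext a; simp [smul_comm c (op (a (Fin.last n)))]

/-- The Hochschild differential `δ^n : C^n(A, M) → C^{n+1}(A, M)`. -/
def d (n : ℕ) : Cochain k A M n →ₗ[k] Cochain k A M (n + 1) :=
  leftTerm n + ∑ i : Fin n, ((-1 : k) ^ (i.val + 1)) • contractTerm i +
    ((-1 : k) ^ (n + 1)) • rightTerm n

theorem d_apply (n : ℕ) (f : Cochain k A M n) (a : Fin (n + 1) → A) :
    d n f a = a 0 • f (fun i => a i.succ) +
      ∑ i : Fin n, ((-1 : k) ^ (i.val + 1)) • f (Fin.contractNth i.castSucc (· * ·) a) +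
      ((-1 : k) ^ (n + 1)) • (op (a (Fin.last n)) • f (fun i => a i.castSucc)) := by
  simp [d, leftTerm, rightTerm, contractTerm, sum_apply]

end Bimodule

/-- The cup product `(f ⌣ g)(a₁, …, a_{n+m}) = f (a₁, …, a_n) g (a_{n+1}, …, a_{n+m})`. -/
def cup (n m : ℕ) : Cochain k A M n →ₗ[k] Cochain k A M m →ₗ[k] Cochain k A M (n + m) :=
  LinearMap.mk₂ k
    (fun f g =>
      { toFun := fun a => f (fun i => a (Fin.castAdd m i)) * g (fun i => a (Fin.natAdd n i))
        map_update_add' := by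
          intro inst a j x y
          obtain rfl : inst = instDecidableEqFin _ := Subsingleton.elim _ _
          refine Fin.addCases (fun j => ?_) (fun j => ?_) j
          · have h1 : ∀ z, (fun i : Fin n => Function.update a (Fin.castAdd m j) z (Fin.castAdd m i)) =
                Function.update (fun i : Fin n => a (Fin.castAdd m i)) j z := by
              intro z; funext i; simp [Function.update_apply]
            have h2 : ∀ z, (fun i : Fin m => Function.update a (Fin.castAdd m j) z (Fin.natAdd n i)) =
                (fun i : Fin m => a (Fin.natAdd n i)) := by
              intro z; funext i
              apply Function.update_of_ne
              simp only [ne_eq, Fin.ext_iff, Fin.val_natAdd, Fin.val_castAdd]; omega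
            simp only [h1, h2, f.map_update_add, add_mul]
          · have h1 : ∀ z, (fun i : Fin m => Function.update a (Fin.natAdd n j) z (Fin.natAdd n i)) =
                Function.update (fun i : Fin m => a (Fin.natAdd n i)) j z := by
              intro z; funext i; simp [Function.update_apply]
            have h2 : ∀ z, (fun i : Fin n => Function.update a (Fin.natAdd n j) z (Fin.castAdd m i)) =
                (fun i : Fin n => a (Fin.castAdd m i)) := by
              intro z; funext i
              apply Function.update_of_ne
              simp only [ne_eq, Fin.ext_iff, Fin.val_natAdd, Fin.val_castAdd]; omega
            simp only [h1, h2, g.map_update_add, mul_add]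
        map_update_smul' := by
          intro inst a j c x
          obtain rfl : inst = instDecidableEqFin _ := Subsingleton.elim _ _
          refine Fin.addCases (fun j => ?_) (fun j => ?_) j
          · have h1 : ∀ z, (fun i : Fin n => Function.update a (Fin.castAdd m j) z (Fin.castAdd m i)) =
                Function.update (fun i : Fin n => a (Fin.castAdd m i)) j z := by
              intro z; funext i; simp [Function.update_apply]
            have h2 : ∀ z, (fun i : Fin m => Function.update a (Fin.castAdd m j) z (Fin.natAdd n i)) =
                (fun i : Fin m => a (Fin.natAdd n i)) := by
              intro z; funext i
              apply Function.update_of_ne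
              simp only [ne_eq, Fin.ext_iff, Fin.val_natAdd, Fin.val_castAdd]; omega
            simp only [h1, h2, f.map_update_smul, smul_mul_assoc]
          · have h1 : ∀ z, (fun i : Fin m => Function.update a (Fin.natAdd n j) z (Fin.natAdd n i)) =
                Function.update (fun i : Fin m => a (Fin.natAdd n i)) j z := by
              intro z; funext i; simp [Function.update_apply]
            have h2 : ∀ z, (fun i : Fin n => Function.update a (Fin.natAdd n j) z (Fin.castAdd m i)) =
                (fun i : Fin n => a (Fin.castAdd m i)) := by
              intro z; funext i
              apply Function.update_of_ne
              simp only [ne_eq, Fin.ext_iff, Fin.val_natAdd, Fin.val_castAdd]; omega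
            simp only [h1, h2, g.map_update_smul, mul_smul_comm] })
    (by intro f f' g; ext a; simp [add_mul])
    (by intro c f g; ext a; simp)
    (by intro f g g'; ext a; simp [mul_add])
    (by intro c f g; ext a; simp)

theorem cup_apply (n m : ℕ) (f : Cochain k A M n) (g : Cochain k A M m) (a : Fin (n + m) → A) :
    cup n m f g a = f (fun i => a (Fin.castAdd m i)) * g (fun i => a (Fin.natAdd n i)) := rfl

end Cochains

/-! ### The group action on cochains, Hochschild cohomology -/

section Action

variable {k A M : Type*} [Field k] [Ring A] [Algebra k A] [Ring M] [Algebra k M]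

section GroupAction

variable {G : Type*} [Group G] [MulSemiringAction G A] [SMulCommClass G k A]
  [MulSemiringAction G M] [SMulCommClass G k M]

/-- The action of `g` on cochains: `(g f)(a₁, …, a_n) = g (f (g⁻¹ a₁, …, g⁻¹ a_n))`. -/
def act (g : G) (n : ℕ) : Cochain k A M n →ₗ[k] Cochain k A M n where
  toFun f := (DistribSMul.toLinearMap k M g).compMultilinearMap
    (f.compLinearMap fun _ => DistribSMul.toLinearMap k A g⁻¹)
  map_add' f f' := by ext a; simp
  map_smul' c f := by ext a; simp

theorem act_apply (g : G) (n : ℕ) (f : Cochain k A M n) (a : Fin n → A) :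
    act g n f a = g • f (fun i => g⁻¹ • a i) := rfl

theorem act_cup (g : G) (n m : ℕ) (f : Cochain k A M n) (f' : Cochain k A M m) :
    act g (n + m) (cup n m f f') = cup n m (act g n f) (act g m f') := by
  ext a
  simp [act_apply, cup_apply, smul_mul']

variable (k A M G) in
/-- `C^n(A, M)^G`. -/
def invCochain (n : ℕ) : Submodule k (Cochain k A M n) where
  carrier := {f | ∀ g : G, act g n f = f}
  add_mem' hf hf' g := by rw [map_add, hf g, hf' g]
  zero_mem' g := map_zero _
  smul_mem' c f hf g := by rw [map_smul, hf g]

theorem cup_mem_invCochain {n m : ℕ} {f : Cochain k A M n} {g : Cochain k A M m}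
    (hf : f ∈ invCochain k A M G n) (hg : g ∈ invCochain k A M G m) :
    cup n m f g ∈ invCochain k A M G (n + m) := fun α => by
  rw [act_cup, hf α, hg α]

end GroupAction

variable [Module A M] [Module Aᵐᵒᵖ M] [IsScalarTower k A M] [IsScalarTower k Aᵐᵒᵖ M]

variable (k A M) in
/-- The cocycles `Ker δ^n`. -/
def cocycles (n : ℕ) : Submodule k (Cochain k A M n) := LinearMap.ker (d n)

/-- For a graded subspace `S` of `C(A, M)`: the space `δ^{n-1}(S^{n-1})`, which is `0` for `n = 0`. -/
def boundaries (S : ∀ n, Submodule k (Cochain k A M n)) : ∀ n, Submodule k (Cochain k A M n)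
  | 0 => ⊥
  | n + 1 => (S n).map (d n)

theorem mem_boundaries_of_cast {S : ∀ n, Submodule k (Cochain k A M n)} {j N : ℕ} (h : j + 1 = N)
    {t : Cochain k A M j} (ht : t ∈ S j) {f : Cochain k A M N}
    (hf : ∀ a : Fin N → A, f a = d j t (fun i => a (Fin.cast h i))) : f ∈ boundaries S N := by
  subst h
  exact ⟨t, ht, by ext a; exact (hf a).symm⟩

variable (k A M) in
/-- The Hochschild cohomology `HH^n(A, M) = Ker δ^n / Im δ^{n-1}`. -/
abbrev HH (n : ℕ) : Type _ :=
  Subquot (cocycles k A M n) (boundaries (fun _ => ⊤) n)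

variable (k A M) in
/-- `HH^n(A, M)^{G↑}`, the `n`-th cohomology of the subcomplex `C(A, M)^G`. -/
abbrev HHup (G : Type*) [Group G] [MulSemiringAction G A] [SMulCommClass G k A]
    [MulSemiringAction G M] [SMulCommClass G k M] (n : ℕ) : Type _ :=
  Subquot (cocycles k A M n ⊓ invCochain k A M G n) (boundaries (invCochain k A M G) n)

theorem d_cup_apply
    (h₁ : ∀ (a : A) (x y : M), (a • x) * y = a • (x * y))
    (h₂ : ∀ (a : A) (x y : M), x * (op a • y) = op a • (x * y))
    (h₃ : ∀ (a : A) (x y : M), (op a • x) * y = x * (a • y))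
    {n m : ℕ} (f : Cochain k A M n) (g : Cochain k A M m) (a : Fin (n + m + 1) → A) :
    d (n + m) (cup n m f g) a =
      d n f (fun i => a ⟨i, by omega⟩) * g (fun i => a ⟨n + 1 + i, by omega⟩) +
      ((-1 : k) ^ n) • (f (fun i => a ⟨i, by omega⟩) * d m g (fun i => a ⟨n + i, by omega⟩)) := by
  have e₁ : ∀ i : Fin n,
      cup n m f g (Fin.contractNth (Fin.castAdd m i).castSucc (· * ·) a) =
      f (Fin.contractNth i.castSucc (· * ·) (fun i : Fin (n + 1) => a ⟨i, by omega⟩)) *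
        g (fun i => a ⟨n + 1 + i, by omega⟩) := by
    intro i
    rw [cup_apply]
    congr 2
    · funext j
      simp only [Fin.contractNth, Fin.val_castSucc, Fin.val_castAdd, Fin.val_natAdd]
      rw [if_neg (by omega), if_neg (by omega)]
      congr 1
      ext
      simp only [Fin.val_succ, Fin.val_natAdd]
      omega
  have e₂ : ∀ i : Fin m,
      cup n m f g (Fin.contractNth (Fin.natAdd n i).castSucc (· * ·) a) =
      f (fun i => a ⟨i, by omega⟩) *
        g (Fin.contractNth i.castSucc (· * ·) (fun i : Fin (m + 1) => a ⟨n + i, by omega⟩)) := by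
    intro i
    rw [cup_apply]
    congr 2
    · funext j
      simp only [Fin.contractNth, Fin.val_castSucc, Fin.val_castAdd, Fin.val_natAdd]
      rw [if_pos (by omega)]
      rfl
    · funext j
      simp only [Fin.contractNth, Fin.val_castSucc, Fin.val_natAdd, Nat.add_lt_add_iff_left,
        Nat.add_left_cancel_iff]
      rfl
  rw [d_apply, d_apply, d_apply, Fin.sum_univ_add]
  simp only [e₁, e₂, Fin.val_castAdd, Fin.val_natAdd, cup_apply]
  have e₃ : (fun i : Fin m => a (Fin.natAdd n i).succ) =
      (fun i : Fin m => a ⟨n + 1 + i, by omega⟩) := by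
    funext i
    congr 1
    ext
    simp only [Fin.val_succ, Fin.val_natAdd]
    omega
  have e₄ : (fun i : Fin m => a ⟨n + (i.succ : Fin (m + 1)), by omega⟩) =
      (fun i : Fin m => a ⟨n + 1 + i, by omega⟩) := by
    funext i
    congr 1
    ext
    simp only [Fin.val_succ]
    omega
  rw [e₃, e₄]
  set F₀ := f (fun i : Fin n => a (Fin.castAdd m i).succ)
  set F₁ := f (fun i : Fin n => a ⟨i, by omega⟩)
  set G₀ := g (fun i : Fin m => a ⟨n + 1 + i, by omega⟩)
  set G₁ := g (fun i : Fin m => a ⟨n + i, by omega⟩)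
  have e₅ : f (fun i : Fin n => a (Fin.castAdd m i).castSucc) = F₁ := rfl
  have e₆ : g (fun i : Fin m => a (Fin.natAdd n i).castSucc) = G₁ := rfl
  have e₇ : f (fun i : Fin n => a ⟨(i.succ : Fin (n + 1)), by omega⟩) = F₀ := rfl
  have e₈ : f (fun i : Fin n => a ⟨(i.castSucc : Fin (n + 1)), by omega⟩) = F₁ := rfl
  have e₉ : g (fun i : Fin m => a ⟨n + (i.castSucc : Fin (m + 1)), by omega⟩) = G₁ := rfl
  rw [e₅, e₆, e₇, e₈, e₉]
  have e₁₀ : a ⟨n + ((0 : Fin (m + 1)) : ℕ), by omega⟩ =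
      a ⟨((Fin.last n : Fin (n + 1)) : ℕ), by simp⟩ := rfl
  have e₁₁ : a ⟨n + ((Fin.last m : Fin (m + 1)) : ℕ), by simp⟩ = a (Fin.last (n + m)) := rfl
  have e₁₂ : a ⟨((0 : Fin (n + 1)) : ℕ), by simp⟩ = a 0 := rfl
  rw [e₁₀, e₁₁, e₁₂]
  simp only [add_mul, mul_add, h₁, h₂, h₃, smul_mul_assoc, mul_smul_comm, Finset.sum_mul,
    Finset.mul_sum, smul_add, Finset.smul_sum, smul_smul]
  have e₁₃ : ∀ i : Fin m, (-1 : k) ^ n * (-1) ^ (i.val + 1) = (-1) ^ (n + i.val + 1) := by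
    intro i; ring
  have e₁₄ : (-1 : k) ^ n * (-1) ^ (m + 1) = (-1) ^ (n + m + 1) := by ring
  have e₁₅ : (-1 : k) ^ (n + 1) = - (-1) ^ n := by ring
  simp only [e₁₃, e₁₄, e₁₅, neg_smul]
  abel

theorem cup_mem_cocycles
    (h₁ : ∀ (a : A) (x y : M), (a • x) * y = a • (x * y))
    (h₂ : ∀ (a : A) (x y : M), x * (op a • y) = op a • (x * y))
    (h₃ : ∀ (a : A) (x y : M), (op a • x) * y = x * (a • y))
    {n m : ℕ} {f : Cochain k A M n} {g : Cochain k A M m}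
    (hf : f ∈ cocycles k A M n) (hg : g ∈ cocycles k A M m) :
    cup n m f g ∈ cocycles k A M (n + m) := by
  rw [cocycles, LinearMap.mem_ker] at *
  ext a
  rw [d_cup_apply h₁ h₂ h₃, hf, hg]
  simp

/-- The product of a coboundary with a cocycle is a coboundary. -/
theorem cup_mem_boundaries_left
    (h₁ : ∀ (a : A) (x y : M), (a • x) * y = a • (x * y))
    (h₂ : ∀ (a : A) (x y : M), x * (op a • y) = op a • (x * y))
    (h₃ : ∀ (a : A) (x y : M), (op a • x) * y = x * (a • y))
    {S : ∀ n, Submodule k (Cochain k A M n)}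
    {n m : ℕ} {f : Cochain k A M n} {g : Cochain k A M m}
    (hS : ∀ j, ∀ t ∈ S j, cup j m t g ∈ S (j + m))
    (hf : f ∈ boundaries S n) (hg : g ∈ cocycles k A M m) :
    cup n m f g ∈ boundaries S (n + m) := by
  rw [cocycles, LinearMap.mem_ker] at hg
  cases n with
  | zero =>
    obtain rfl : f = 0 := hf
    simp
  | succ j =>
    obtain ⟨t, ht, rfl⟩ := hf
    refine mem_boundaries_of_cast (j := j + m) (by omega) (hS j t ht) fun a => ?_
    rw [d_cup_apply h₁ h₂ h₃, hg, cup_apply]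
    simp only [zero_apply, mul_zero, smul_zero, add_zero]
    rfl

/-- The product of a cocycle with a coboundary is a coboundary. -/
theorem cup_mem_boundaries_right
    (h₁ : ∀ (a : A) (x y : M), (a • x) * y = a • (x * y))
    (h₂ : ∀ (a : A) (x y : M), x * (op a • y) = op a • (x * y))
    (h₃ : ∀ (a : A) (x y : M), (op a • x) * y = x * (a • y))
    {S : ∀ n, Submodule k (Cochain k A M n)}
    {n m : ℕ} {f : Cochain k A M n} {g : Cochain k A M m}
    (hS : ∀ j, ∀ t ∈ S j, cup n j f t ∈ S (n + j))
    (hf : f ∈ cocycles k A M n) (hg : g ∈ boundaries S m) :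
    cup n m f g ∈ boundaries S (n + m) := by
  rw [cocycles, LinearMap.mem_ker] at hf
  cases m with
  | zero =>
    obtain rfl : g = 0 := hg
    simp
  | succ j =>
    obtain ⟨t, ht, rfl⟩ := hg
    refine mem_boundaries_of_cast (j := n + j) (t := ((-1 : k) ^ n) • cup n j f t) (by omega)
      ((S (n + j)).smul_mem _ (hS j t ht)) fun a => ?_
    rw [map_smul, smul_apply, d_cup_apply h₁ h₂ h₃, hf, cup_apply, smul_add,
      smul_smul, ← mul_pow]
    simp only [zero_apply, zero_mul, smul_zero, zero_add, mul_neg, mul_one, neg_neg,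
      one_pow, one_smul]
    rfl

end Action

/-! ### Hochschild cohomology as a graded algebra with a `G`-action -/

section Cohomology

variable (k A M G : Type*) [Field k] [Ring A] [Algebra k A] [Ring M] [Algebra k M]
  [Module A M] [Module Aᵐᵒᵖ M] [SMulCommClass A Aᵐᵒᵖ M]
  [IsScalarTower k A M] [IsScalarTower k Aᵐᵒᵖ M]
  [Group G] [MulSemiringAction G A] [SMulCommClass G k A]
  [MulSemiringAction G M] [SMulCommClass G k M] [hM : IsAeGModuleAlgebra k A M G]

variable {k A M G} in
theorem d_act (g : G) (n : ℕ) (f : Cochain k A M n) : d n (act g n f) = act g (n + 1) (d n f) := by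
  ext a
  have h : ∀ i : Fin n, (fun j => g⁻¹ • Fin.contractNth i.castSucc (· * ·) a j) =
      Fin.contractNth i.castSucc (· * ·) (fun j => g⁻¹ • a j) := by
    intro i
    exact Fin.comp_contractNth (f := fun x : A => g⁻¹ • x) _ _ (fun x y => smul_mul' _ _ _) _ _
  simp only [act_apply, d_apply, smul_add, Finset.smul_sum, hM.group_smul, hM.group_op_smul, h,
    smul_inv_smul, smul_comm g]

/-- The cup product `HH^n(A, M) × HH^m(A, M) → HH^{n+m}(A, M)`. -/
def cupHH (n m : ℕ) : HH k A M n →ₗ[k] HH k A M m →ₗ[k] HH k A M (n + m) :=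
  Subquot.map₂ (cup n m)
    (cocycles k A M n) (boundaries (fun _ => ⊤) n)
    (cocycles k A M m) (boundaries (fun _ => ⊤) m)
    (cocycles k A M (n + m)) (boundaries (fun _ => ⊤) (n + m))
    (fun _ hf _ hg => cup_mem_cocycles hM.smul_mul hM.mul_op_smul hM.op_smul_mul hf hg)
    (fun _ _ hf _ hg => cup_mem_boundaries_left hM.smul_mul hM.mul_op_smul hM.op_smul_mul
      (fun _ _ _ => Submodule.mem_top) hf hg)
    (fun _ hf _ _ hg => cup_mem_boundaries_right hM.smul_mul hM.mul_op_smul hM.op_smul_mul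
      (fun _ _ _ => Submodule.mem_top) hf hg)

/-- The cup product `HH^n(A, M)^{G↑} × HH^m(A, M)^{G↑} → HH^{n+m}(A, M)^{G↑}`. -/
def cupUp (n m : ℕ) : HHup k A M G n →ₗ[k] HHup k A M G m →ₗ[k] HHup k A M G (n + m) :=
  Subquot.map₂ (cup n m)
    (cocycles k A M n ⊓ invCochain k A M G n) (boundaries (invCochain k A M G) n)
    (cocycles k A M m ⊓ invCochain k A M G m) (boundaries (invCochain k A M G) m)
    (cocycles k A M (n + m) ⊓ invCochain k A M G (n + m)) (boundaries (invCochain k A M G) (n + m))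
    (fun _ hf _ hg => ⟨cup_mem_cocycles hM.smul_mul hM.mul_op_smul hM.op_smul_mul hf.1 hg.1,
      cup_mem_invCochain hf.2 hg.2⟩)
    (fun _ _ hf _ hg => cup_mem_boundaries_left hM.smul_mul hM.mul_op_smul hM.op_smul_mul
      (fun _ _ ht => cup_mem_invCochain ht hg.2) hf hg.1)
    (fun _ hf _ _ hg => cup_mem_boundaries_right hM.smul_mul hM.mul_op_smul hM.op_smul_mul
      (fun _ _ ht => cup_mem_invCochain hf.2 ht) hf.1 hg)

/-- The homomorphism `Θ : HH^n(A, M)^{G↑} → HH^n(A, M)` induced by `C(A, M)^G ⊂ C(A, M)`; its image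
lies in `HH^n(A, M)^G`. -/
def Theta (n : ℕ) : HHup k A M G n →ₗ[k] HH k A M n :=
  Subquot.map LinearMap.id _ _ _ _ (fun _ hf => hf.1) (fun f _ hf => by
    cases n with
    | zero => exact hf
    | succ n =>
      obtain ⟨t, _, rfl⟩ := hf
      exact ⟨t, trivial, rfl⟩)

/-- The action of `g ∈ G` on `HH^n(A, M)`. -/
def actHH (g : G) (n : ℕ) : HH k A M n →ₗ[k] HH k A M n :=
  Subquot.map (act g n) _ _ _ _
    (fun f hf => by
      rw [cocycles, LinearMap.mem_ker] at *
      rw [d_act, hf, map_zero])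
    (fun f _ hf => by
      cases n with
      | zero =>
        obtain rfl : f = 0 := hf
        simp
      | succ n =>
        obtain ⟨t, _, rfl⟩ := hf
        exact ⟨act g n t, trivial, d_act g n t⟩)

/-- `HH^n(A, M)^K`, the elements of `HH^n(A, M)` fixed by the subgroup `K` of `G`. -/
def invHH (K : Subgroup G) (n : ℕ) : Submodule k (HH k A M n) where
  carrier := {x | ∀ g ∈ K, actHH k A M G g n x = x}
  add_mem' hx hy g hg := by rw [map_add, hx g hg, hy g hg]
  zero_mem' g _ := map_zero _
  smul_mem' c x hx g hg := by rw [map_smul, hx g hg]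

/-- The operator `Δ_ρ = 1 - ρ` on `HH^n(A, M)`. -/
def DeltaHH (ρ : G) (n : ℕ) : Module.End k (HH k A M n) := 1 - actHH k A M G ρ n

/-- The operator `Δ_ρ = 1 - ρ` on `M`. -/
def DeltaM (ρ : G) : Module.End k M := 1 - DistribSMul.toLinearMap k M ρ

theorem actHH_cupHH (g : G) (n m : ℕ) (x : HH k A M n) (y : HH k A M m) :
    actHH k A M G g (n + m) (cupHH k A M G n m x y) =
      cupHH k A M G n m (actHH k A M G g n x) (actHH k A M G g m y) := by
  obtain ⟨f, rfl⟩ := Subquot.mk_surjective _ _ x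
  obtain ⟨f', rfl⟩ := Subquot.mk_surjective _ _ y
  simp only [actHH, cupHH, Subquot.map_mk, Subquot.map₂_mk, act_cup]

theorem Theta_cupUp (n m : ℕ) (x : HHup k A M G n) (y : HHup k A M G m) :
    Theta k A M G (n + m) (cupUp k A M G n m x y) =
      cupHH k A M G n m (Theta k A M G n x) (Theta k A M G m y) := by
  obtain ⟨f, rfl⟩ := Subquot.mk_surjective _ _ x
  obtain ⟨f', rfl⟩ := Subquot.mk_surjective _ _ y
  rfl

theorem Theta_mem_invHH (n : ℕ) (x : HHup k A M G n) : Theta k A M G n x ∈ invHH k A M G ⊤ n := by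
  obtain ⟨f, rfl⟩ := Subquot.mk_surjective _ _ x
  intro g _
  simp only [Theta, actHH, Subquot.map_mk, LinearMap.id_apply, f.2.2 g]

theorem cupHH_mem_invHH {n m : ℕ} {x : HH k A M n} {y : HH k A M m}
    (hx : x ∈ invHH k A M G ⊤ n) (hy : y ∈ invHH k A M G ⊤ m) :
    cupHH k A M G n m x y ∈ invHH k A M G ⊤ (n + m) := fun g hg => by
  rw [actHH_cupHH, hx g hg, hy g hg]

end Cohomology

/-! ### Graded bimodules, their graded subbimodules, quotients and isomorphisms -/

section GradedAction

/-- The left and right multiplications of a graded bimodule `V = ⊕ V_n` over a graded algebra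
`R = ⊕ R_n`: `left m n b x = b x` and `right m n b x = x b` for `b ∈ R_m`, `x ∈ V_n`. -/
structure GradedAction (k : Type*) [Field k] (R V : ℕ → Type*)
    [∀ n, AddCommGroup (R n)] [∀ n, Module k (R n)]
    [∀ n, AddCommGroup (V n)] [∀ n, Module k (V n)] where
  left : ∀ m n, R m →ₗ[k] V n →ₗ[k] V (m + n)
  right : ∀ m n, R m →ₗ[k] V n →ₗ[k] V (n + m)

variable {k : Type*} [Field k] {R V W : ℕ → Type*}
  [∀ n, AddCommGroup (R n)] [∀ n, Module k (R n)]
  [∀ n, AddCommGroup (V n)] [∀ n, Module k (V n)]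
  [∀ n, AddCommGroup (W n)] [∀ n, Module k (W n)]

/-- `S = ⊕ S_n` is a graded subbimodule of `V`. -/
def GradedAction.IsSubbimodule (P : GradedAction k R V) (S : ∀ n, Submodule k (V n)) : Prop :=
  ∀ (m n : ℕ) (b : R m), ∀ x ∈ S n, P.left m n b x ∈ S (m + n) ∧ P.right m n b x ∈ S (n + m)

/-- The graded bimodule `S / S'`, for graded subbimodules `S' ⊂ S` of `V`. -/
def GradedAction.quotient (P : GradedAction k R V) {S S' : ∀ n, Submodule k (V n)}
    (hS : P.IsSubbimodule S) (hS' : P.IsSubbimodule S') :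
    GradedAction k R (fun n => Subquot (S n) (S' n)) where
  left m n := Subquot.mapRight (P.left m n) (S n) (S' n) (S (m + n)) (S' (m + n))
    (fun b x hx => (hS m n b x hx).1) (fun b x _ hx => (hS' m n b x hx).1)
  right m n := Subquot.mapRight (P.right m n) (S n) (S' n) (S (n + m)) (S' (n + m))
    (fun b x hx => (hS m n b x hx).2) (fun b x _ hx => (hS' m n b x hx).2)

/-- An isomorphism of graded bimodules (it preserves degrees). -/
structure GradedAction.Iso (P : GradedAction k R V) (Q : GradedAction k R W) where
  equiv : ∀ n, V n ≃ₗ[k] W n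
  map_left : ∀ (m n : ℕ) (b : R m) (x : V n),
    equiv (m + n) (P.left m n b x) = Q.left m n b (equiv n x)
  map_right : ∀ (m n : ℕ) (b : R m) (x : V n),
    equiv (n + m) (P.right m n b x) = Q.right m n b (equiv n x)

end GradedAction

/-! ### The algebra `𝒜`, the bimodules `X` and `Y`, degenerated algebras -/

section Main

variable (k A M G : Type*) [Field k] [Ring A] [Algebra k A] [Ring M] [Algebra k M]
  [Module A M] [Module Aᵐᵒᵖ M] [SMulCommClass A Aᵐᵒᵖ M]
  [IsScalarTower k A M] [IsScalarTower k Aᵐᵒᵖ M]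
  [Group G] [MulSemiringAction G A] [SMulCommClass G k A]
  [MulSemiringAction G M] [SMulCommClass G k M] [hM : IsAeGModuleAlgebra k A M G]

/-- The degree `n` part of the graded algebra `𝒜 = Im Θ ⊂ HH^*(A, M)^G`. -/
def imTheta (n : ℕ) : Submodule k (HH k A M n) := LinearMap.range (Theta k A M G n)

/-- The degree `n` part of `X = Ker Θ ⊂ HH^*(A, M)^{G↑}`. -/
def kerTheta (n : ℕ) : Submodule k (HHup k A M G n) := LinearMap.ker (Theta k A M G n)

/-- The degree `n` part of `Y = HH^*(A, M)^G / Im Θ`. -/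
abbrev cokerTheta (n : ℕ) : Type _ := Subquot (invHH k A M G ⊤ n) (imTheta k A M G n)

/-- `Θ` as a map onto `𝒜`. -/
def toImTheta (n : ℕ) : HHup k A M G n →ₗ[k] imTheta k A M G n := (Theta k A M G n).rangeRestrict

theorem imTheta_le_invHH (n : ℕ) : imTheta k A M G n ≤ invHH k A M G ⊤ n := by
  rintro _ ⟨x, rfl⟩
  exact Theta_mem_invHH k A M G n x

variable {k A M G} in
theorem cupHH_mem_imTheta {n m : ℕ} {x : HH k A M n} {y : HH k A M m}
    (hx : x ∈ imTheta k A M G n) (hy : y ∈ imTheta k A M G m) :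
    cupHH k A M G n m x y ∈ imTheta k A M G (n + m) := by
  obtain ⟨x, rfl⟩ := hx
  obtain ⟨y, rfl⟩ := hy
  exact ⟨cupUp k A M G n m x y, Theta_cupUp k A M G n m x y⟩

/-- The `𝒜`-bimodule structure of `Y`, given by the cup product of `HH^*(A, M)^G`. -/
def cokerAction : GradedAction k (fun n => imTheta k A M G n) (fun n => cokerTheta k A M G n) where
  left m n := Subquot.mapRight ((cupHH k A M G m n).comp (imTheta k A M G m).subtype)
    (invHH k A M G ⊤ n) (imTheta k A M G n) (invHH k A M G ⊤ (m + n)) (imTheta k A M G (m + n))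
    (fun b _ hx => cupHH_mem_invHH k A M G (imTheta_le_invHH k A M G m b.2) hx)
    (fun b _ _ hx => cupHH_mem_imTheta b.2 hx)
  right m n := Subquot.mapRight ((cupHH k A M G n m).flip.comp (imTheta k A M G m).subtype)
    (invHH k A M G ⊤ n) (imTheta k A M G n) (invHH k A M G ⊤ (n + m)) (imTheta k A M G (n + m))
    (fun b _ hx => cupHH_mem_invHH k A M G hx (imTheta_le_invHH k A M G m b.2))
    (fun b _ _ hx => cupHH_mem_imTheta hx b.2)

/-- `P` is the `𝒜`-bimodule structure of `X` induced by the cup product of `HH^*(A, M)^{G↑}`: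
`Θ(b) x = b ⌣ x` and `x Θ(b) = x ⌣ b`.  There is at most one such `P`, and there is one if and only
if the ideal `X` has square zero. -/
def IsKerAction (P : GradedAction k (fun n => imTheta k A M G n) (fun n => kerTheta k A M G n)) :
    Prop :=
  ∀ (m n : ℕ) (b : HHup k A M G m) (x : kerTheta k A M G n),
    (P.left m n (toImTheta k A M G m b) x : HHup k A M G (m + n)) = cupUp k A M G m n b x ∧
    (P.right m n (toImTheta k A M G m b) x : HHup k A M G (n + m)) = cupUp k A M G n m x b

variable {k A M G}

/-- `M` is an `(𝐦, 𝐡)`-degenerated algebra: `𝐦 ∈ M^H` and `𝐡 ∈ Der(A, M)^H` satisfy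
`Δ_ρ^{q-1} 𝐦 = 1` and `Δ_ρ 𝐡 + φ_𝐦 = 0`, where `φ_𝐦(a) = a 𝐦 - 𝐦 a`.  Here `H` is a normal subgroup
of `G`, `ρ ∈ G` represents a generator of the cyclic group `G / H`, `q` is the order of `G / H`. -/
structure IsDegenerated (H : Subgroup G) (ρ : G) (q : ℕ) (m : M) (h : A →ₗ[k] M) : Prop where
  m_inv : ∀ g ∈ H, g • m = m
  h_inv : ∀ g ∈ H, ∀ a, g • h (g⁻¹ • a) = h a
  h_der : ∀ a b, h (a * b) = a • h b + op b • h a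
  norm_m : (DeltaM k M G ρ ^ (q - 1)) m = 1
  delta_h : ∀ a, (h a - ρ • h (ρ⁻¹ • a)) + (a • m - op a • m) = 0

end Main

end HochG

/-! Write `C = C(A, M)`, `Δ = Δ_ρ` and `B = δ(C^H)`. Since `p` does not divide `|H|`, averaging over
`H` identifies `HH^*(A, M)^H` with the cohomology of `C^H`, and all work is done there. On `C^H` one
has `Δ^q = 1 - ρ^q = 0`, and `Δ^{q-1}` is the norm `1 + ρ + ⋯ + ρ^{q-1}`.

The element `m` has norm `1`, so `Δ^{q-1}(m f) = f` for every `G`-invariant `f`. Hence `Ker Δ^a = Im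
Δ^{q-a}` on `C^H` (`exists_deltaC_pow_eq`): in each degree `C^H` is free over `k[Δ]/(Δ^q)`. In
particular `C^G = Δ^{q-1} C^H` and `δ(C^G) = Δ^{q-1} B`.

The derivation `h` transfers divisibility by `Δ` from cochains to cocycles: if an element of `B`
equals `Δ^j w` with `w` in `C^H` and `j ≤ q`, then `w` can be replaced by a cocycle
(`exists_cocycle_deltaC_pow_eq`). For this, `C ⊕ C` gets the differential `D(u, v) = (δu + h ⌣ v,
δv)` and the operator `(u, v) ↦ (ρu + m ρv, ρv)`. They commute because the failure of multiplication
by `m` to commute with `δ` is the cup product with `φ_m = ρh - h`. If `T` is `1` minus this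
operator, then `T^q(u, v) = (-v, 0)` on `H`-fixed pairs, so `T^q` links the two copies of `C`.

Now let `X_l` consist of the classes of invariant cocycles in `Δ^l B`, and let `Y_i` be the image of
`Δ^i HH^H ∩ HH^G`. For `i + 2 ≤ q` let `Z_i` be the space of `H`-invariant cocycles `w` with
`Δ^{i+1} w ∈ B`. The maps `w ↦ [Δ^i w]` and `w ↦ [Δ^{q-1} w]` send `Z_i` onto `Y_i` and `X_{q-2-i}`,
and by `deltaC_pow_mem_map_iff` the preimages of `Y_{i+1}` and `X_{q-1-i}` coincide. This gives the
isomorphisms of quotients; they respect products because `Δ` commutes with multiplication by an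
invariant cocycle.

The ideal `X` has square zero: its elements have the form `x = Δ^{q-1} w` with `w` a cocycle, and
for a second element `x'`, which lies in `B`, `x ⌣ x' = Δ^{q-1}(w ⌣ x')` lies in `Δ^{q-1} B =
δ(C^G)`. Finally, if `Δ^i HH^H = HH^G`, then the filtration of `Y` can jump only at step `i`, hence
that of `X` only at the matching step. -/

namespace HochG

open MulOpposite

/-! ### Powers of `1 - r` in characteristic `p` -/

section Polynomial

variable {k V : Type*} [Field k] [AddCommGroup V] [Module k V]

theorem one_sub_pow_card (p : ℕ) [Fact p.Prime] [CharP k p] (e : ℕ) (r : Module.End k V) :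
    (1 - r) ^ p ^ e = 1 - r ^ p ^ e := by
  have h : (1 - Polynomial.X : Polynomial k) ^ p ^ e = 1 - Polynomial.X ^ p ^ e := by
    rw [sub_pow_char_pow, one_pow]
  simpa using congrArg (Polynomial.aeval r) h

/-- Both sides become `1 - X^q` after multiplication by `1 - X`. This factor can be cancelled in
`k[X]` but not among endomorphisms, so the identity is proved for polynomials and then evaluated. -/
theorem one_sub_pow_card_sub_one (p : ℕ) [Fact p.Prime] [CharP k p] (e : ℕ) (r : Module.End k V) :
    (1 - r) ^ (p ^ e - 1) = ∑ a ∈ Finset.range (p ^ e), r ^ a := by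
  have hp : 0 < p ^ e := pow_pos (Fact.out : p.Prime).pos e
  have h : (1 - Polynomial.X : Polynomial k) ^ (p ^ e - 1) =
      ∑ a ∈ Finset.range (p ^ e), Polynomial.X ^ a := by
    have h0 : (1 - Polynomial.X : Polynomial k) ≠ 0 := by
      intro h
      simpa using congrArg (Polynomial.eval 0) h
    apply mul_left_cancel₀ h0
    rw [← pow_succ', Nat.sub_add_cancel hp, mul_neg_geom_sum, sub_pow_char_pow, one_pow]
  simpa using congrArg (Polynomial.aeval r) h

end Polynomial

/-! ### Cup products with an element of `M` and with a derivation -/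

section Operators

variable {k A M G : Type*} [Field k] [Ring A] [Algebra k A] [Ring M] [Algebra k M]

/-- The left multiplication of cochains by an element of `M`. -/
def mulCochain (n : ℕ) : M →ₗ[k] Cochain k A M n →ₗ[k] Cochain k A M n :=
  LinearMap.mk₂ k (fun m f => (LinearMap.mulLeft k m).compMultilinearMap f)
    (by intro m m' f; ext a; simp [add_mul]) (by intro c m f; ext a; simp)
    (by intro m f f'; ext a; simp) (by intro c m f; ext a; simp)

theorem mulCochain_apply (n : ℕ) (m : M) (f : Cochain k A M n) (a : Fin n → A) :
    mulCochain n m f a = m * f a := rfl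

/-- The cup product `(h ⌣ f)(a₀, …, a_n) = h (a₀) f (a₁, …, a_n)` with a `1`-cochain. -/
def consCochain (n : ℕ) :
    (A →ₗ[k] M) →ₗ[k] Cochain k A M n →ₗ[k] Cochain k A M (n + 1) :=
  LinearMap.mk₂ k (fun h f => ((mulCochain n).flip f ∘ₗ h).uncurryLeft)
    (by intro m m' f; ext a; simp) (by intro c m f; ext a; simp)
    (by intro m f f'; ext a; simp) (by intro c m f; ext a; simp)

theorem consCochain_apply (n : ℕ) (h : A →ₗ[k] M) (f : Cochain k A M n) (a : Fin (n + 1) → A) :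
    consCochain n h f a = h (a 0) * f (fun i => a i.succ) := rfl

section Differential

variable [Module A M] [Module Aᵐᵒᵖ M] [IsScalarTower k A M] [IsScalarTower k Aᵐᵒᵖ M]

variable (k A) in
/-- The inner derivation `φ_m(a) = a m - m a`. -/
def innerDer (m : M) : A →ₗ[k] M where
  toFun a := a • m - op a • m
  map_add' a b := by simp only [add_smul, op_add]; abel
  map_smul' c a := by simp [smul_sub]

theorem innerDer_apply (m : M) (a : A) : innerDer k A m a = a • m - op a • m := rfl

/-- The Leibniz rule for the `0`-cochain `m`, whose coboundary is `φ_m`. The products by `0`- and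
`1`-cochains are kept apart from `cup` so that degrees are `n` and `n + 1` on the nose, rather than
`0 + n` and `1 + n`. -/
theorem d_mulCochain
    (h₁ : ∀ (a : A) (x y : M), (a • x) * y = a • (x * y))
    (h₂ : ∀ (a : A) (x y : M), x * (op a • y) = op a • (x * y))
    (h₃ : ∀ (a : A) (x y : M), (op a • x) * y = x * (a • y))
    (n : ℕ) (m : M) (f : Cochain k A M n) :
    d n (mulCochain n m f) = mulCochain (n + 1) m (d n f) + consCochain n (innerDer k A m) f := by
  ext a
  simp only [add_apply, d_apply, mulCochain_apply, consCochain_apply,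
    innerDer_apply, mul_add, sub_mul, h₁, h₃, Finset.mul_sum, mul_smul_comm, h₂]
  abel

/-- The Leibniz rule for a `1`-cocycle: the derivation rule for `h` says `δh = 0`, and only the term
with sign `(-1)^1` survives. -/
theorem d_consCochain
    (h₁ : ∀ (a : A) (x y : M), (a • x) * y = a • (x * y))
    (h₂ : ∀ (a : A) (x y : M), x * (op a • y) = op a • (x * y))
    (h₃ : ∀ (a : A) (x y : M), (op a • x) * y = x * (a • y))
    (n : ℕ) (h : A →ₗ[k] M) (hder : ∀ a b, h (a * b) = a • h b + op b • h a)
    (f : Cochain k A M n) :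
    d (n + 1) (consCochain n h f) = -consCochain (n + 1) h (d n f) := by
  ext a
  have e₁ : ∀ i : Fin n, (fun j : Fin n =>
      Fin.contractNth (Fin.castSucc i.succ) (· * ·) a j.succ) =
      Fin.contractNth i.castSucc (· * ·) (fun j => a j.succ) := by
    intro i
    funext j
    simp only [Fin.contractNth, Fin.val_castSucc, Fin.val_succ, Nat.add_lt_add_iff_right,
      Nat.add_right_cancel_iff]
    rfl
  have e₂ : (fun j : Fin n => Fin.contractNth (0 : Fin (n + 2)) (· * ·) a j.succ) =
      fun j => a j.succ.succ := by
    funext j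
    simp [Fin.contractNth]
  have e₃ : Fin.contractNth (0 : Fin (n + 2)) (· * ·) a 0 = a 0 * a 1 := by
    simp [Fin.contractNth]
  have e₄ : ∀ i : Fin n, Fin.contractNth (Fin.castSucc i.succ) (· * ·) a 0 = a 0 := by
    intro i
    simp [Fin.contractNth]
  simp only [neg_apply, d_apply, consCochain_apply, Fin.sum_univ_succ, e₁, e₂, e₃,
    e₄, hder, add_mul, mul_add, h₁, h₂, h₃, Finset.mul_sum, mul_smul_comm, Fin.val_zero,
    Fin.val_succ, pow_succ, mul_neg, mul_one, neg_neg, neg_smul, one_smul, pow_zero,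
    Finset.sum_neg_distrib, neg_add_rev, smul_add, Fin.succ_zero_eq_one,
    Fin.castSucc_zero, Fin.succ_last, Fin.succ_castSucc]
  abel

end Differential

section GroupAction

variable [Group G] [MulSemiringAction G A] [SMulCommClass G k A]
  [MulSemiringAction G M] [SMulCommClass G k M]

theorem act_one (n : ℕ) : act (k := k) (A := A) (M := M) (1 : G) n = 1 := by
  ext f a
  simp [act_apply]

theorem act_mul (g g' : G) (n : ℕ) :
    act (k := k) (A := A) (M := M) (g * g') n = act g n * act g' n := by
  ext f a
  simp [act_apply, mul_smul]

theorem act_pow (g : G) (n j : ℕ) :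
    act (k := k) (A := A) (M := M) (g ^ j) n = act g n ^ j := by
  induction j with
  | zero => simp [act_one]
  | succ j ih => rw [pow_succ, pow_succ, act_mul, ih]

theorem act_mulCochain (g : G) (n : ℕ) (m : M) (f : Cochain k A M n) :
    act g n (mulCochain n m f) = mulCochain n (g • m) (act g n f) := by
  ext a
  simp [act_apply, mulCochain_apply, smul_mul']

variable (k) in
/-- The action of `g` on linear maps `A → M`. -/
def actLinearMap (g : G) (h : A →ₗ[k] M) : A →ₗ[k] M :=
  DistribSMul.toLinearMap k M g ∘ₗ h ∘ₗ DistribSMul.toLinearMap k A g⁻¹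

theorem actLinearMap_apply (g : G) (h : A →ₗ[k] M) (a : A) :
    actLinearMap k g h a = g • h (g⁻¹ • a) := rfl

theorem act_consCochain (g : G) (n : ℕ) (h : A →ₗ[k] M) (f : Cochain k A M n) :
    act g (n + 1) (consCochain n h f) = consCochain n (actLinearMap k g h) (act g n f) := by
  ext a
  simp [act_apply, consCochain_apply, actLinearMap_apply, smul_mul']

end GroupAction

end Operators

/-! ### The square of the Hochschild differential is zero -/

section Squared

/-- The terms at `(j + 1, i)` and `(i, j)` with `i ≤ j` carry opposite signs and cancel in pairs.
The induction strips off the last row and the last column, which cancel each other. -/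
theorem sum_sum_neg_one_pow_eq_zero {k V : Type*} [Field k] [AddCommGroup V] [Module k V]
    (F : ℕ → ℕ → V) (N : ℕ) (hF : ∀ i j, i ≤ j → j < N → F (j + 1) i = F i j) :
    ∑ j ∈ Finset.range (N + 1), ((-1 : k) ^ j) • ∑ i ∈ Finset.range N, ((-1 : k) ^ i) • F j i = 0 := by
  induction N with
  | zero => simp
  | succ N ih =>
    have ih := ih fun i j hij hj => hF i j hij (by omega)
    rw [Finset.sum_range_succ]
    simp only [Finset.sum_range_succ _ N, smul_add, Finset.sum_add_distrib]
    simp only [Finset.sum_range_succ _ N] at ih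
    rw [eq_neg_of_add_eq_zero_left ih, hF N N le_rfl (by omega)]
    have h : ∀ i ∈ Finset.range N, (-1 : k) ^ i • F (N + 1) i = (-1 : k) ^ i • F i N := by
      intro i hi
      rw [hF i N (Finset.mem_range.1 hi).le (by omega)]
    rw [Finset.sum_congr rfl h]
    simp only [Finset.smul_sum, smul_smul, pow_succ', one_mul, neg_mul, neg_smul,
      Finset.sum_neg_distrib, mul_comm ((-1 : k) ^ N)]
    abel

/-- Multiplication of two neighbouring terms of a sequence. -/
def contractSeq {A : Type*} [Mul A] (i : ℕ) (a : ℕ → A) (j : ℕ) : A :=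
  if j < i then a j else if j = i then a j * a (j + 1) else a (j + 1)

variable {k A M : Type*} [Field k] [Ring A] [Algebra k A] [Ring M] [Algebra k M]
  [Module A M] [Module Aᵐᵒᵖ M]

/-- The `i`-th face in the Hochschild differential of an `n`-cochain, regarded as a function of
sequences. -/
def faceSeq (n i : ℕ) (φ : (ℕ → A) → M) (a : ℕ → A) : M :=
  if i = 0 then a 0 • φ (fun j => a (j + 1))
  else if i = n + 1 then op (a n) • φ a
  else φ (contractSeq (i - 1) a)

/-- The presimplicial identities. Sequences indexed by `ℕ` avoid all casts between `Fin` types; the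
price is that the last face does not truncate its argument, so `hφ` is needed when both faces are
right multiplications. -/
theorem faceSeq_faceSeq [SMulCommClass A Aᵐᵒᵖ M] {n i j : ℕ} (hij : i ≤ j) (hj : j < n + 2)
    {φ : (ℕ → A) → M} (hφ : ∀ a b : ℕ → A, (∀ l < n, a l = b l) → φ a = φ b) (a : ℕ → A) :
    faceSeq (n + 1) (j + 1) (faceSeq n i φ) a = faceSeq (n + 1) i (faceSeq n j φ) a := by
  rcases Nat.eq_zero_or_pos i with rfl | hi
  · rcases Nat.eq_zero_or_pos j with rfl | hj₀
    · simp [faceSeq, contractSeq, mul_smul]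
    · rcases eq_or_ne j (n + 1) with rfl | hj₁
      · simp [faceSeq, smul_comm]
      · simp only [faceSeq, contractSeq, if_pos, if_neg hj₀.ne', if_neg hj₁, if_pos hj₀,
          Nat.add_eq_zero_iff, one_ne_zero, and_false, if_false, Nat.add_right_cancel_iff,
          Nat.add_sub_cancel]
        congr 2
        funext l
        simp only [contractSeq]
        split_ifs <;> first | rfl | omega
  · rcases eq_or_ne j (n + 1) with rfl | hj₁
    · rcases eq_or_ne i (n + 1) with rfl | hi₁
      · simp only [faceSeq, Nat.add_eq_zero_iff, one_ne_zero, and_false, if_false, if_true,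
          Nat.add_sub_cancel, Nat.add_right_cancel_iff, contractSeq, lt_irrefl,
          (Nat.succ_ne_self n).symm, op_mul, mul_smul]
        congr 2
        refine hφ _ _ fun l hl => ?_
        rw [contractSeq, if_pos hl]
      · simp only [faceSeq, Nat.add_eq_zero_iff, one_ne_zero, and_false, if_false, if_true,
          if_neg hi.ne', if_neg hi₁, if_neg (show i ≠ n + 1 + 1 by omega)]
        rw [show contractSeq (i - 1) a n = a (n + 1) by
          rw [contractSeq, if_neg (by omega), if_neg (by omega)]]
    · simp only [faceSeq, Nat.add_eq_zero_iff, one_ne_zero, and_false, if_false,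
        if_neg hi.ne', if_neg (show i ≠ n + 1 by omega), if_neg (show i ≠ n + 1 + 1 by omega),
        if_neg (show j ≠ 0 by omega), if_neg hj₁, Nat.add_right_cancel_iff, Nat.add_sub_cancel]
      congr 1
      funext l
      simp only [contractSeq]
      split_ifs <;> first | rfl | omega | rw [mul_assoc]

variable [IsScalarTower k A M] [IsScalarTower k Aᵐᵒᵖ M]

theorem d_apply_seq (n : ℕ) (f : Cochain k A M n) (a : ℕ → A) :
    d n f (fun j => a j) =
      ∑ i ∈ Finset.range (n + 2), ((-1 : k) ^ i) • faceSeq n i (fun b => f fun j => b j) a := by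
  rw [d_apply, Finset.sum_range_succ, Finset.sum_range_succ', Finset.sum_range]
  have h : ∀ i : Fin n, faceSeq n (i + 1) (fun b => f fun j => b j) a =
      f (Fin.contractNth i.castSucc (· * ·) fun j : Fin (n + 1) => a j) := by
    intro i
    rw [faceSeq, if_neg (by omega), if_neg (by omega)]
    rfl
  simp only [h]
  simp only [faceSeq, if_pos, Nat.add_eq_zero_iff, one_ne_zero, and_false, if_false, pow_zero,
    one_smul, Fin.val_succ, Fin.val_castSucc, Fin.val_last, Fin.val_zero]
  abel

theorem d_d [SMulCommClass A Aᵐᵒᵖ M] (n : ℕ) (f : Cochain k A M n) : d (n + 1) (d n f) = 0 := by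
  ext a
  -- The padding by `0` is arbitrary: only the first `n + 2` terms enter.
  obtain ⟨b, rfl⟩ : ∃ b : ℕ → A, a = fun j : Fin (n + 1 + 1) => b j :=
    ⟨fun j => if hj : j < n + 1 + 1 then a ⟨j, hj⟩ else 0, by funext j; simp [j.2]⟩
  have hd : (fun b : ℕ → A => d n f fun j => b j) = fun b => ∑ i ∈ Finset.range (n + 2),
      ((-1 : k) ^ i) • faceSeq n i (fun b => f fun j => b j) b := funext (d_apply_seq n f)
  have hlin : ∀ j, faceSeq (n + 1) j (fun b : ℕ → A => d n f fun j => b j) b =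
      ∑ i ∈ Finset.range (n + 2), ((-1 : k) ^ i) •
        faceSeq (n + 1) j (faceSeq n i fun b => f fun j => b j) b := by
    intro j
    rw [hd]
    simp only [faceSeq.eq_1 (n + 1)]
    split_ifs
    · simp only [Finset.smul_sum, smul_comm (b 0)]
    · simp only [Finset.smul_sum, smul_comm (op (b (n + 1)))]
    · rfl
  rw [d_apply_seq]
  simp only [hlin]
  exact sum_sum_neg_one_pow_eq_zero _ (n + 2) fun i j hij hj =>
    faceSeq_faceSeq hij hj (fun a b hab => congrArg f (funext fun l => hab l l.2)) b

end Squared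

/-! ### `C^H` as a module over `k[Δ]`, and the twisted extension of `C` by itself -/

section Degenerated

variable {k A M G : Type*} [Field k] [Ring A] [Algebra k A] [Ring M] [Algebra k M]
  [Group G] [MulSemiringAction G A] [SMulCommClass G k A]
  [MulSemiringAction G M] [SMulCommClass G k M]

variable (k A M) in
/-- `C^n(A, M)^H` for a subgroup `H`. -/
def fixedCochain (H : Subgroup G) (n : ℕ) : Submodule k (Cochain k A M n) where
  carrier := {f | ∀ g ∈ H, act g n f = f}
  add_mem' hf hf' g hg := by rw [map_add, hf g hg, hf' g hg]
  zero_mem' g _ := map_zero _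
  smul_mem' c f hf g hg := by rw [map_smul, hf g hg]

/-- The operator `Δ_ρ = 1 - ρ` on cochains. -/
def deltaC (ρ : G) (n : ℕ) : Module.End k (Cochain k A M n) := 1 - act ρ n

theorem deltaC_apply (ρ : G) (n : ℕ) (f : Cochain k A M n) : deltaC ρ n f = f - act ρ n f := rfl

theorem act_mem_fixedCochain {H : Subgroup G} [H.Normal] (ρ : G) {n : ℕ} {f : Cochain k A M n}
    (hf : f ∈ fixedCochain k A M H n) : act ρ n f ∈ fixedCochain k A M H n := fun g hg => by
  have h := hf (ρ⁻¹ * g * ρ) (by simpa using ‹H.Normal›.conj_mem g hg ρ⁻¹)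
  conv_rhs => rw [← h]
  rw [← Module.End.mul_apply, ← Module.End.mul_apply, ← act_mul, ← act_mul]
  congr 2
  group

theorem deltaC_mem_fixedCochain {H : Subgroup G} [H.Normal] (ρ : G) {n : ℕ} {f : Cochain k A M n}
    (hf : f ∈ fixedCochain k A M H n) : deltaC ρ n f ∈ fixedCochain k A M H n :=
  Submodule.sub_mem _ hf (act_mem_fixedCochain ρ hf)

theorem deltaC_pow_mem_fixedCochain {H : Subgroup G} [H.Normal] (ρ : G) {n : ℕ}
    {f : Cochain k A M n} (j : ℕ) (hf : f ∈ fixedCochain k A M H n) :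
    (deltaC ρ n ^ j) f ∈ fixedCochain k A M H n := by
  induction j with
  | zero => simpa using hf
  | succ j ih =>
    rw [pow_succ', Module.End.mul_apply]
    exact deltaC_mem_fixedCochain ρ ih

theorem mulCochain_mem_fixedCochain {H : Subgroup G} {n : ℕ} {m : M} (hm : ∀ g ∈ H, g • m = m)
    {f : Cochain k A M n} (hf : f ∈ fixedCochain k A M H n) :
    mulCochain n m f ∈ fixedCochain k A M H n := fun g hg => by
  rw [act_mulCochain, hm g hg, hf g hg]

theorem consCochain_mem_fixedCochain {H : Subgroup G} {n : ℕ} {h : A →ₗ[k] M}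
    (hh : ∀ g ∈ H, actLinearMap k g h = h)
    {f : Cochain k A M n} (hf : f ∈ fixedCochain k A M H n) :
    consCochain n h f ∈ fixedCochain k A M H (n + 1) := fun g hg => by
  rw [act_consCochain, hh g hg, hf g hg]

/-- The automorphism of the extension `C^n ⊕ C^n` of `C^n` by itself that lifts `ρ` and is twisted
by `m`. -/
def twistedAct (ρ : G) (m : M) (n : ℕ) : Module.End k (Cochain k A M n × Cochain k A M n) :=
  LinearMap.prod (act ρ n ∘ₗ LinearMap.fst k _ _ +
    mulCochain n m ∘ₗ act ρ n ∘ₗ LinearMap.snd k _ _) (act ρ n ∘ₗ LinearMap.snd k _ _)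

theorem twistedAct_apply (ρ : G) (m : M) (n : ℕ) (u v : Cochain k A M n) :
    twistedAct ρ m n (u, v) = (act ρ n u + mulCochain n m (act ρ n v), act ρ n v) := rfl

/-- The off-diagonal entry accumulates the partial sums of the norm of `m`. At `j = q` the sum is
`1`, which is what makes the extension useful. -/
theorem twistedAct_pow_apply (ρ : G) (m : M) (n j : ℕ) (u v : Cochain k A M n) :
    (twistedAct ρ m n ^ j) (u, v) =
      (act (ρ ^ j) n u + mulCochain n (∑ a ∈ Finset.range j, ρ ^ a • m) (act (ρ ^ j) n v),
        act (ρ ^ j) n v) := by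
  induction j with
  | zero => simp [act_one]
  | succ j ih =>
    have hact : ∀ f : Cochain k A M n, act ρ n (act (ρ ^ j) n f) = act (ρ ^ (j + 1)) n f := by
      intro f
      rw [pow_succ', act_mul, Module.End.mul_apply]
    rw [pow_succ', Module.End.mul_apply, ih, twistedAct_apply, map_add, act_mulCochain, hact, hact,
      add_assoc, ← LinearMap.add_apply, ← map_add, Finset.sum_range_succ' _ j, Finset.smul_sum]
    simp [pow_succ', mul_smul]

/-- The operator `1 - ρ` on the twisted extension `C^n ⊕ C^n`. -/
def twistedDelta (ρ : G) (m : M) (n : ℕ) : Module.End k (Cochain k A M n × Cochain k A M n) :=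
  1 - twistedAct ρ m n

theorem twistedDelta_apply (ρ : G) (m : M) (n : ℕ) (u v : Cochain k A M n) :
    twistedDelta ρ m n (u, v) = (deltaC ρ n u - mulCochain n m (act ρ n v), deltaC ρ n v) := by
  rw [twistedDelta, LinearMap.sub_apply, twistedAct_apply, deltaC_apply, deltaC_apply]
  simp [sub_sub]

theorem snd_twistedDelta_pow (ρ : G) (m : M) (n j : ℕ) (x : Cochain k A M n × Cochain k A M n) :
    ((twistedDelta ρ m n ^ j) x).2 = (deltaC ρ n ^ j) x.2 := by
  induction j with
  | zero => simp
  | succ j ih =>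
    rw [pow_succ', Module.End.mul_apply, pow_succ', Module.End.mul_apply, ← ih]
    exact congrArg Prod.snd (twistedDelta_apply ρ m n _ _)

theorem fst_twistedDelta_pow_mem {H : Subgroup G} [H.Normal] (ρ : G) {m : M}
    (hm : ∀ g ∈ H, g • m = m) {n : ℕ} (j : ℕ) {x : Cochain k A M n × Cochain k A M n}
    (h₁ : x.1 ∈ fixedCochain k A M H n) (h₂ : x.2 ∈ fixedCochain k A M H n) :
    ((twistedDelta ρ m n ^ j) x).1 ∈ fixedCochain k A M H n := by
  induction j with
  | zero => simpa using h₁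
  | succ j ih =>
    rw [pow_succ', Module.End.mul_apply]
    have h := congrArg Prod.fst (twistedDelta_apply ρ m n ((twistedDelta ρ m n ^ j) x).1
      ((twistedDelta ρ m n ^ j) x).2)
    rw [Prod.mk.eta] at h
    rw [h, snd_twistedDelta_pow]
    exact Submodule.sub_mem _ (deltaC_mem_fixedCochain ρ ih)
      (mulCochain_mem_fixedCochain hm (act_mem_fixedCochain ρ (deltaC_pow_mem_fixedCochain ρ j h₂)))

variable [Module A M] [Module Aᵐᵒᵖ M] [IsScalarTower k A M] [IsScalarTower k Aᵐᵒᵖ M]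

/-- The differential of the twisted extension `C ⊕ C`. -/
def twistedD (h : A →ₗ[k] M) (n : ℕ) :
    Cochain k A M n × Cochain k A M n →ₗ[k] Cochain k A M (n + 1) × Cochain k A M (n + 1) :=
  LinearMap.prod (d n ∘ₗ LinearMap.fst k _ _ + consCochain n h ∘ₗ LinearMap.snd k _ _)
    (d n ∘ₗ LinearMap.snd k _ _)

theorem twistedD_apply (h : A →ₗ[k] M) (n : ℕ) (u v : Cochain k A M n) :
    twistedD h n (u, v) = (d n u + consCochain n h v, d n v) := rfl

variable [SMulCommClass A Aᵐᵒᵖ M] [hM : IsAeGModuleAlgebra k A M G]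

theorem d_deltaC_pow (ρ : G) (n j : ℕ) (f : Cochain k A M n) :
    d n ((deltaC ρ n ^ j) f) = (deltaC ρ (n + 1) ^ j) (d n f) := by
  induction j with
  | zero => rfl
  | succ j ih =>
    rw [pow_succ', Module.End.mul_apply, pow_succ', Module.End.mul_apply, ← ih, deltaC_apply,
      deltaC_apply, map_sub, d_act]

theorem d_mem_fixedCochain {H : Subgroup G} {n : ℕ} {f : Cochain k A M n}
    (hf : f ∈ fixedCochain k A M H n) : d n f ∈ fixedCochain k A M H (n + 1) := fun g hg => by
  rw [← d_act, hf g hg]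

variable (k A M) in
/-- The data of an `(m, h)`-degenerated algebra over a group `G` with a normal subgroup `H` such that
`G / H` is cyclic of order `p ^ e` with generator `ρ`, in terms of the norm of `m`. -/
structure NormData (H : Subgroup G) (ρ : G) (p e : ℕ) (m : M) (h : A →ₗ[k] M) : Prop where
  exists_pow_mul : ∀ g, ∃ j : ℕ, ∃ x ∈ H, g = ρ ^ j * x
  pow_mem : ρ ^ p ^ e ∈ H
  m_inv : ∀ g ∈ H, g • m = m
  h_inv : ∀ g ∈ H, actLinearMap k g h = h
  h_der : ∀ a b, h (a * b) = a • h b + op b • h a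
  norm_m : ∑ a ∈ Finset.range (p ^ e), ρ ^ a • m = 1
  delta_h : actLinearMap k ρ h = h + innerDer k A m

namespace NormData

variable {H : Subgroup G} {ρ : G} {p e : ℕ} {m : M} {h : A →ₗ[k] M}

/-- Moving `δ` past multiplication by `m` produces `φ_m ⌣ ρv`, and moving `ρ` past `h ⌣ v` produces
`(h + φ_m) ⌣ ρv`. The two occurrences of `φ_m` match. -/
theorem twistedD_twistedDelta_pow (D : NormData k A M H ρ p e m h) (n j : ℕ)
    (x : Cochain k A M n × Cochain k A M n) :
    twistedD h n ((twistedDelta ρ m n ^ j) x) = (twistedDelta ρ m (n + 1) ^ j) (twistedD h n x) := by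
  induction j with
  | zero => rfl
  | succ j ih =>
    rw [pow_succ', Module.End.mul_apply, pow_succ', Module.End.mul_apply, ← ih]
    obtain ⟨u, v⟩ := (twistedDelta ρ m n ^ j) x
    simp only [twistedDelta_apply, twistedD_apply, deltaC_apply, map_sub, map_add, d_act,
      act_consCochain, D.delta_h, d_mulCochain hM.smul_mul hM.mul_op_smul hM.op_smul_mul,
      LinearMap.add_apply]
    refine Prod.ext ?_ rfl
    dsimp only
    abel

theorem twistedD_twistedD (D : NormData k A M H ρ p e m h) (n : ℕ)
    (x : Cochain k A M n × Cochain k A M n) :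
    twistedD h (n + 1) (twistedD h n x) = 0 := by
  obtain ⟨u, v⟩ := x
  rw [twistedD_apply, twistedD_apply, map_add, d_d, d_d,
    d_consCochain hM.smul_mul hM.mul_op_smul hM.op_smul_mul n h D.h_der]
  simp

omit [SMulCommClass A Aᵐᵒᵖ M] hM in
theorem mem_invCochain_iff (D : NormData k A M H ρ p e m h) {n : ℕ} {f : Cochain k A M n} :
    f ∈ invCochain k A M G n ↔ f ∈ fixedCochain k A M H n ∧ deltaC ρ n f = 0 := by
  refine ⟨fun hf => ⟨fun g _ => hf g, sub_eq_zero.2 (hf ρ).symm⟩, fun ⟨h₁, h₂⟩ g => ?_⟩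
  obtain ⟨j, x, hx, rfl⟩ := D.exists_pow_mul g
  have h₃ : act ρ n f = f := (sub_eq_zero.1 h₂).symm
  rw [act_mul, Module.End.mul_apply, h₁ x hx, act_pow]
  induction j with
  | zero => rfl
  | succ j ih => rw [pow_succ, Module.End.mul_apply, h₃, ih]

variable [Fact p.Prime] [CharP k p]

omit [SMulCommClass A Aᵐᵒᵖ M] hM in
theorem deltaC_pow_eq_zero (D : NormData k A M H ρ p e m h) {n : ℕ} {f : Cochain k A M n}
    (hf : f ∈ fixedCochain k A M H n) : (deltaC ρ n ^ p ^ e) f = 0 := by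
  rw [deltaC, one_sub_pow_card, LinearMap.sub_apply, ← act_pow, hf _ D.pow_mem]
  simp

omit [SMulCommClass A Aᵐᵒᵖ M] hM in
-- For invariant `f` one has `ρ^a (m f) = (ρ^a m) f`, so the norm of `m f` is the norm of `m` times
-- `f`.
theorem deltaC_pow_mulCochain (D : NormData k A M H ρ p e m h) {n : ℕ} {f : Cochain k A M n}
    (hf : f ∈ invCochain k A M G n) : (deltaC ρ n ^ (p ^ e - 1)) (mulCochain n m f) = f := by
  have hf' : ∀ g : G, act g n f = f := hf
  rw [deltaC, one_sub_pow_card_sub_one, LinearMap.sum_apply]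
  simp only [← act_pow, act_mulCochain, hf']
  rw [← LinearMap.sum_apply, ← map_sum, D.norm_m]
  ext a
  simp [mulCochain_apply]

omit [SMulCommClass A Aᵐᵒᵖ M] hM in
-- In characteristic `p` this is `1` minus the `q`-th power of the twisted action; `ρ^q ∈ H` fixes
-- both components, and only the norm of `m` remains.
theorem twistedDelta_pow (D : NormData k A M H ρ p e m h) {n : ℕ}
    {x : Cochain k A M n × Cochain k A M n} (h₁ : x.1 ∈ fixedCochain k A M H n)
    (h₂ : x.2 ∈ fixedCochain k A M H n) :
    (twistedDelta ρ m n ^ p ^ e) x = (-x.2, 0) := by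
  obtain ⟨u, v⟩ := x
  rw [twistedDelta, one_sub_pow_card, LinearMap.sub_apply, twistedAct_pow_apply, D.norm_m,
    h₁ _ D.pow_mem, h₂ _ D.pow_mem]
  refine Prod.ext ?_ (sub_self _)
  ext a
  simp [mulCochain_apply]

variable [H.Normal]

omit [SMulCommClass A Aᵐᵒᵖ M] hM in
-- Freeness of `C^H` over `k[Δ]/(Δ^q)`, in the form `Ker Δ^a ⊂ Im Δ^{q-a}`. The lowest nonzero layer
-- `Δ^a f` is invariant, hence a norm; subtracting the corresponding multiple of `Δ^{q-a-1}` lowers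
-- the order of nilpotency of `f`.
theorem exists_deltaC_pow_eq (D : NormData k A M H ρ p e m h) {n a : ℕ} (ha : a ≤ p ^ e)
    {f : Cochain k A M n} (hf : f ∈ fixedCochain k A M H n) (hf₀ : (deltaC ρ n ^ a) f = 0) :
    ∃ g ∈ fixedCochain k A M H n, (deltaC ρ n ^ (p ^ e - a)) g = f := by
  induction a generalizing f with
  | zero => exact ⟨0, Submodule.zero_mem _, by simpa using hf₀.symm⟩
  | succ a ih =>
    have hinv : (deltaC ρ n ^ a) f ∈ invCochain k A M G n :=
      D.mem_invCochain_iff.2 ⟨deltaC_pow_mem_fixedCochain ρ a hf, by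
        rwa [← Module.End.mul_apply, ← pow_succ']⟩
    set g := mulCochain n m ((deltaC ρ n ^ a) f) with hg
    have hgf : g ∈ fixedCochain k A M H n :=
      mulCochain_mem_fixedCochain D.m_inv (deltaC_pow_mem_fixedCochain ρ a hf)
    have hg₁ : (deltaC ρ n ^ a) ((deltaC ρ n ^ (p ^ e - (a + 1))) g) = (deltaC ρ n ^ a) f := by
      rw [← Module.End.mul_apply, ← pow_add, show a + (p ^ e - (a + 1)) = p ^ e - 1 by omega]
      exact D.deltaC_pow_mulCochain hinv
    obtain ⟨g', hg', hgg'⟩ := ih (by omega)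
      (Submodule.sub_mem _ hf (deltaC_pow_mem_fixedCochain ρ (p ^ e - (a + 1)) hgf))
      (by rw [map_sub, hg₁, sub_self])
    refine ⟨g + deltaC ρ n g', Submodule.add_mem _ hgf (deltaC_mem_fixedCochain ρ hg'), ?_⟩
    rw [map_add, ← Module.End.mul_apply _ (deltaC ρ n) g', ← pow_succ,
      show p ^ e - (a + 1) + 1 = p ^ e - a by omega, hgg']
    abel

/-- A coboundary divisible by a power of `Δ_ρ` is the multiple of a cocycle. -/
theorem exists_cocycle_deltaC_pow_eq (D : NormData k A M H ρ p e m h)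
    {n j : ℕ} (hj : j ≤ p ^ e)
    {z : Cochain k A M n} (hz : z ∈ fixedCochain k A M H n)
    {w : Cochain k A M (n + 1)} (hw : w ∈ fixedCochain k A M H (n + 1))
    (hzw : d n z = (deltaC ρ (n + 1) ^ j) w) :
    ∃ w' ∈ fixedCochain k A M H (n + 1), d (n + 1) w' = 0 ∧
      (deltaC ρ (n + 1) ^ j) w' = d n z := by
  set T := twistedDelta (k := k) (A := A) ρ m (n + 1) with hT
  have hzero : (0 : Cochain k A M (n + 1)) ∈ fixedCochain k A M H (n + 1) := Submodule.zero_mem _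
  -- The pair `(0, w)` solves `T^j b = D(0, z)` up to its first component, which is `s` instead of
  -- `h ⌣ z`.
  set s := ((T ^ j) (0, w)).1 with hs
  have hTs : (T ^ j) (0, w) = (s, d n z) := Prod.ext rfl (by rw [snd_twistedDelta_pow, hzw])
  have hsf : s ∈ fixedCochain k A M H (n + 1) := fst_twistedDelta_pow_mem ρ D.m_inv j hzero hw
  have hy : s - consCochain n h z ∈ fixedCochain k A M H (n + 1) :=
    Submodule.sub_mem _ hsf (consCochain_mem_fixedCochain D.h_inv hz)
  -- Since `T^q(0, y) = (-y, 0)`, this correction changes the first component of `T^j b` from `s` to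
  -- `h ⌣ z` and leaves the second alone.
  set b := (0, w) + (T ^ (p ^ e - j)) (0, s - consCochain n h z) with hb
  have hb₁ : b.1 ∈ fixedCochain k A M H (n + 1) :=
    Submodule.add_mem _ hzero (fst_twistedDelta_pow_mem ρ D.m_inv _ hzero hy)
  have hb₂ : b.2 ∈ fixedCochain k A M H (n + 1) := by
    refine Submodule.add_mem _ hw ?_
    rw [snd_twistedDelta_pow]
    exact deltaC_pow_mem_fixedCochain ρ _ hy
  have hTb : (T ^ j) b = twistedD h n (0, z) := by
    rw [hb, map_add, hTs, ← Module.End.mul_apply, ← pow_add, Nat.add_sub_cancel' hj,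
      D.twistedDelta_pow hzero hy, twistedD_apply]
    refine Prod.ext ?_ ?_ <;> simp
  -- `T^q D b = T^{q-j} D (T^j b) = T^{q-j} D D (0, z) = 0`, whereas the first component of `T^q D
  -- b` is `-δ(b.2)`. So `b.2` is a cocycle.
  have hTD : (twistedDelta ρ m (n + 1 + 1) ^ p ^ e) (twistedD h (n + 1) b) = 0 := by
    rw [← Nat.sub_add_cancel hj, pow_add, Module.End.mul_apply, ← D.twistedD_twistedDelta_pow,
      hTb, D.twistedD_twistedD n, map_zero]
  rw [D.twistedDelta_pow (Submodule.add_mem _ (d_mem_fixedCochain hb₁)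
    (consCochain_mem_fixedCochain D.h_inv hb₂)) (d_mem_fixedCochain hb₂)] at hTD
  refine ⟨b.2, hb₂, neg_eq_zero.1 (congrArg Prod.fst hTD), ?_⟩
  rw [← snd_twistedDelta_pow ρ m, hTb]
  rfl

end NormData

end Degenerated

/-! ### Averaging over `H` -/

section Average

variable {k A M G : Type*} [Field k] [Ring A] [Algebra k A] [Ring M] [Algebra k M]
  [Group G] [MulSemiringAction G A] [SMulCommClass G k A]
  [MulSemiringAction G M] [SMulCommClass G k M]

theorem cup_mem_fixedCochain {H : Subgroup G} {n m : ℕ} {f : Cochain k A M n} {g : Cochain k A M m}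
    (hf : f ∈ fixedCochain k A M H n) (hg : g ∈ fixedCochain k A M H m) :
    cup n m f g ∈ fixedCochain k A M H (n + m) := fun α hα => by
  rw [act_cup, hf α hα, hg α hα]

theorem deltaC_pow_cup_right (ρ : G) (j : ℕ) {n m : ℕ} {f : Cochain k A M n} {g : Cochain k A M m}
    (hf : act ρ n f = f) : (deltaC ρ (n + m) ^ j) (cup n m f g) = cup n m f ((deltaC ρ m ^ j) g) := by
  induction j with
  | zero => rfl
  | succ j ih =>
    rw [pow_succ', Module.End.mul_apply, ih, deltaC_apply, act_cup, hf, ← map_sub, pow_succ',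
      Module.End.mul_apply, deltaC_apply]

theorem deltaC_pow_cup_left (ρ : G) (j : ℕ) {n m : ℕ} {f : Cochain k A M n} {g : Cochain k A M m}
    (hg : act ρ m g = g) : (deltaC ρ (n + m) ^ j) (cup n m f g) = cup n m ((deltaC ρ n ^ j) f) g := by
  induction j with
  | zero => rfl
  | succ j ih =>
    rw [pow_succ', Module.End.mul_apply, ih, deltaC_apply, act_cup, hg, ← LinearMap.map_sub₂,
      pow_succ', Module.End.mul_apply, deltaC_apply]

variable (k A M) in
/-- The average of a cochain over a finite subgroup. -/
noncomputable def average (H : Subgroup G) (n : ℕ) : Module.End k (Cochain k A M n) :=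
  ((Nat.card H : k)⁻¹) • ∑ᶠ g : H, act (g : G) n

theorem average_apply (H : Subgroup G) [Fintype H] (n : ℕ) (f : Cochain k A M n) :
    average k A M H n f = ((Nat.card H : k)⁻¹) • ∑ g : H, act (g : G) n f := by
  rw [average, finsum_eq_sum_of_fintype, LinearMap.smul_apply, LinearMap.sum_apply]

theorem average_mem_fixedCochain (H : Subgroup G) [Finite H] (n : ℕ) (f : Cochain k A M n) :
    average k A M H n f ∈ fixedCochain k A M H n := fun g hg => by
  have := Fintype.ofFinite H
  rw [average_apply, map_smul, map_sum]
  congr 1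
  refine Fintype.sum_equiv (Equiv.mulLeft (⟨g, hg⟩ : H)) _ _ fun x => ?_
  rw [← Module.End.mul_apply, ← act_mul]
  rfl

/-- The average of `f` is congruent to `f` modulo a subspace if all `g f`, `g ∈ H`, are. -/
theorem average_sub_mem (H : Subgroup G) [Finite H] (hH : (Nat.card H : k) ≠ 0) {n : ℕ}
    {f : Cochain k A M n} {S : Submodule k (Cochain k A M n)}
    (hf : ∀ g ∈ H, act g n f - f ∈ S) : average k A M H n f - f ∈ S := by
  have := Fintype.ofFinite H
  have h : average k A M H n f - f = ((Nat.card H : k)⁻¹) • ∑ g : H, (act (g : G) n f - f) := by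
    rw [average_apply, Finset.sum_sub_distrib, smul_sub, Finset.sum_const, Finset.card_univ,
      ← Nat.card_eq_fintype_card, ← Nat.cast_smul_eq_nsmul k, smul_smul, inv_mul_cancel₀ hH,
      one_smul]
  rw [h]
  exact S.smul_mem _ (S.sum_mem fun g _ => hf g g.2)

theorem average_eq_self (H : Subgroup G) [Finite H] (hH : (Nat.card H : k) ≠ 0) {n : ℕ}
    {f : Cochain k A M n} (hf : f ∈ fixedCochain k A M H n) : average k A M H n f = f :=
  sub_eq_zero.1 ((Submodule.mem_bot k).1 (average_sub_mem H hH fun g hg => by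
    rw [hf g hg, sub_self]; exact Submodule.zero_mem _))

variable [Module A M] [Module Aᵐᵒᵖ M] [IsScalarTower k A M] [IsScalarTower k Aᵐᵒᵖ M]
  [SMulCommClass A Aᵐᵒᵖ M] [hM : IsAeGModuleAlgebra k A M G]

theorem d_average (H : Subgroup G) [Finite H] (n : ℕ) (f : Cochain k A M n) :
    d n (average k A M H n f) = average k A M H (n + 1) (d n f) := by
  have := Fintype.ofFinite H
  simp only [average_apply, map_smul, map_sum, d_act]

/-- A primitive of an `H`-fixed coboundary may be averaged, since averaging commutes with `δ` and
fixes the coboundary. -/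
theorem mem_boundaries_fixedCochain (H : Subgroup G) [Finite H] (hH : (Nat.card H : k) ≠ 0) {n : ℕ}
    {f : Cochain k A M n} (hf : f ∈ fixedCochain k A M H n) (hf' : f ∈ boundaries (fun _ => ⊤) n) :
    f ∈ boundaries (fixedCochain k A M H) n := by
  cases n with
  | zero => exact hf'
  | succ n =>
    obtain ⟨t, -, rfl⟩ := hf'
    exact ⟨average k A M H n t, average_mem_fixedCochain H n t, by
      rw [d_average, average_eq_self H hH hf]⟩

end Average

/-! ### Coboundaries, powers of `Δ`, and the comparison of the two filtrations -/

section Boundaries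

variable {k A M G : Type*} [Field k] [Ring A] [Algebra k A] [Ring M] [Algebra k M]
  [Module A M] [Module Aᵐᵒᵖ M] [IsScalarTower k A M] [IsScalarTower k Aᵐᵒᵖ M]

theorem boundaries_mono {S T : ∀ n, Submodule k (Cochain k A M n)} (hST : ∀ n, S n ≤ T n) (n : ℕ) :
    boundaries S n ≤ boundaries T n := by
  cases n with
  | zero => exact le_rfl
  | succ n => exact Submodule.map_mono (hST n)

variable [SMulCommClass A Aᵐᵒᵖ M]

theorem boundaries_le_cocycles (S : ∀ n, Submodule k (Cochain k A M n)) (n : ℕ) :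
    boundaries S n ≤ cocycles k A M n := by
  cases n with
  | zero => exact bot_le
  | succ n =>
    rintro _ ⟨t, -, rfl⟩
    exact d_d n t

variable [Group G] [MulSemiringAction G A] [SMulCommClass G k A]
  [MulSemiringAction G M] [SMulCommClass G k M] [hM : IsAeGModuleAlgebra k A M G]

theorem act_mem_boundaries (g : G) {n : ℕ} {f : Cochain k A M n}
    (hf : f ∈ boundaries (fun _ => ⊤) n) : act g n f ∈ boundaries (fun _ => ⊤) n := by
  cases n with
  | zero =>
    obtain rfl : f = 0 := hf
    rw [map_zero]
    exact Submodule.zero_mem _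
  | succ n =>
    obtain ⟨t, -, rfl⟩ := hf
    exact ⟨act g n t, trivial, d_act g n t⟩

theorem boundaries_fixedCochain_le (H : Subgroup G) (n : ℕ) :
    boundaries (fixedCochain k A M H) n ≤ fixedCochain k A M H n := by
  cases n with
  | zero => exact bot_le
  | succ n =>
    rintro _ ⟨t, ht, rfl⟩
    exact d_mem_fixedCochain ht

theorem deltaC_pow_mem_boundaries {H : Subgroup G} [H.Normal] (ρ : G) (j : ℕ) {n : ℕ}
    {f : Cochain k A M n} (hf : f ∈ boundaries (fixedCochain k A M H) n) :
    (deltaC ρ n ^ j) f ∈ boundaries (fixedCochain k A M H) n := by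
  cases n with
  | zero =>
    obtain rfl : f = 0 := hf
    rw [map_zero]
    exact Submodule.zero_mem _
  | succ n =>
    obtain ⟨t, ht, rfl⟩ := hf
    exact ⟨_, deltaC_pow_mem_fixedCochain ρ j ht, d_deltaC_pow ρ n j t⟩

theorem deltaC_pow_mem_cocycles (ρ : G) (j : ℕ) {n : ℕ}
    {f : Cochain k A M n} (hf : f ∈ cocycles k A M n) : (deltaC ρ n ^ j) f ∈ cocycles k A M n := by
  rw [cocycles, LinearMap.mem_ker] at *
  rw [d_deltaC_pow, hf, map_zero]

namespace NormData

variable {H : Subgroup G} {ρ : G} {p e : ℕ} {m : M} {h : A →ₗ[k] M} [Fact p.Prime] [CharP k p]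
  [H.Normal]

omit [SMulCommClass A Aᵐᵒᵖ M] hM in
theorem deltaC_pow_sub_one_mem (D : NormData k A M H ρ p e m h) {n : ℕ} {f : Cochain k A M n}
    (hf : f ∈ fixedCochain k A M H n) :
    (deltaC ρ n ^ (p ^ e - 1)) f ∈ invCochain k A M G n := by
  refine D.mem_invCochain_iff.2 ⟨deltaC_pow_mem_fixedCochain ρ _ hf, ?_⟩
  rw [← Module.End.mul_apply, ← pow_succ',
    Nat.sub_add_cancel (pow_pos (Fact.out : p.Prime).pos e), D.deltaC_pow_eq_zero hf]

/-- Apply `δ` to `C^G = Δ^{q-1} C^H`: an invariant `t` is the norm of `m t`, and every norm of an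
`H`-fixed cochain is invariant. -/
theorem boundaries_invCochain (D : NormData k A M H ρ p e m h) (n : ℕ) :
    boundaries (invCochain k A M G) n =
      (boundaries (fixedCochain k A M H) n).map (deltaC ρ n ^ (p ^ e - 1)) := by
  cases n with
  | zero => exact (Submodule.map_bot _).symm
  | succ n =>
    ext f
    constructor
    · rintro ⟨t, ht, rfl⟩
      refine ⟨_, ⟨mulCochain n m t, mulCochain_mem_fixedCochain D.m_inv
        (D.mem_invCochain_iff.1 ht).1, rfl⟩, ?_⟩
      rw [← d_deltaC_pow, D.deltaC_pow_mulCochain ht]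
    · rintro ⟨_, ⟨t, ht, rfl⟩, rfl⟩
      exact ⟨_, D.deltaC_pow_sub_one_mem ht, d_deltaC_pow ρ n _ t⟩

theorem exists_cocycle_of_mem_boundaries (D : NormData k A M H ρ p e m h) {n j : ℕ}
    (hj : j ≤ p ^ e) {y w : Cochain k A M n} (hy : y ∈ boundaries (fixedCochain k A M H) n)
    (hw : w ∈ fixedCochain k A M H n) (hyw : (deltaC ρ n ^ j) w = y) :
    ∃ w' ∈ fixedCochain k A M H n, w' ∈ cocycles k A M n ∧ (deltaC ρ n ^ j) w' = y := by
  cases n with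
  | zero =>
    obtain rfl : y = 0 := hy
    exact ⟨0, Submodule.zero_mem _, Submodule.zero_mem _, map_zero _⟩
  | succ n =>
    obtain ⟨z, hz, rfl⟩ := hy
    exact D.exists_cocycle_deltaC_pow_eq hj hz hw hyw.symm

/-- An element of `Δ^l δ(C^H)` that is `G`-invariant is the norm of a cocycle `w` such that
`Δ^{q-1-l} w` is a coboundary. -/
theorem exists_cocycle_of_mem_map (D : NormData k A M H ρ p e m h) {n l : ℕ} (hl : l < p ^ e)
    {x : Cochain k A M n} (hx : x ∈ invCochain k A M G n)
    (hxl : x ∈ (boundaries (fixedCochain k A M H) n).map (deltaC ρ n ^ l)) :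
    ∃ w ∈ fixedCochain k A M H n, w ∈ cocycles k A M n ∧
      (deltaC ρ n ^ (p ^ e - 1 - l)) w ∈ boundaries (fixedCochain k A M H) n ∧
      (deltaC ρ n ^ (p ^ e - 1)) w = x := by
  obtain ⟨y, hy, rfl⟩ := hxl
  have h₁ : (deltaC ρ n ^ (l + 1)) y = 0 := by
    rw [pow_succ', Module.End.mul_apply]
    exact (D.mem_invCochain_iff.1 hx).2
  -- Invariance of `x = Δ^l y` puts `y` in `Ker Δ^{l+1} = Im Δ^{q-1-l}`; as `y` is a coboundary, the
  -- preimage can then be made a cocycle.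
  obtain ⟨w₀, hw₀, hyw₀⟩ := D.exists_deltaC_pow_eq (by omega)
    (boundaries_fixedCochain_le H n hy) h₁
  obtain ⟨w, hw, hwc, hyw⟩ := D.exists_cocycle_of_mem_boundaries (by omega) hy hw₀ hyw₀
  rw [show p ^ e - (l + 1) = p ^ e - 1 - l by omega] at hyw
  refine ⟨w, hw, hwc, hyw ▸ hy, ?_⟩
  rw [← hyw, ← Module.End.mul_apply, ← pow_add, show l + (p ^ e - 1 - l) = p ^ e - 1 by omega]

/-- The product of two invariant cocycles that bound in `C(A, M)` bounds in `C(A, M)^G`. -/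
theorem cup_mem_boundaries_invCochain (D : NormData k A M H ρ p e m h) {n r : ℕ}
    {x : Cochain k A M n} {x' : Cochain k A M r} (hx : x ∈ invCochain k A M G n)
    (hxb : x ∈ boundaries (fixedCochain k A M H) n) (hx' : x' ∈ invCochain k A M G r)
    (hxb' : x' ∈ boundaries (fixedCochain k A M H) r) :
    cup n r x x' ∈ boundaries (invCochain k A M G) (n + r) := by
  obtain ⟨w, hw, hwc, -, rfl⟩ := D.exists_cocycle_of_mem_map (l := 0)
    (pow_pos (Fact.out : p.Prime).pos e) hx ⟨x, hxb, rfl⟩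
  rw [D.boundaries_invCochain]
  -- With `x = Δ^{q-1} w`, the product is `Δ^{q-1}(w ⌣ x')`, and `w ⌣ x'` is a cocycle times a
  -- coboundary.
  refine ⟨cup n r w x', ?_, deltaC_pow_cup_left ρ _ (hx' ρ)⟩
  exact cup_mem_boundaries_right hM.smul_mul hM.mul_op_smul hM.op_smul_mul
    (fun j t ht => cup_mem_fixedCochain hw ht) hwc hxb'

/-- The comparison of the filtration of `Y` by powers of `Δ` with the filtration of `X`. -/
theorem deltaC_pow_mem_map_iff (D : NormData k A M H ρ p e m h) {n i : ℕ} (hi : i + 2 ≤ p ^ e)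
    {w : Cochain k A M n} (hw : w ∈ fixedCochain k A M H n) (hwc : w ∈ cocycles k A M n)
    (hwi : (deltaC ρ n ^ (i + 1)) w ∈ boundaries (fixedCochain k A M H) n) :
    (∃ w' ∈ fixedCochain k A M H n, w' ∈ cocycles k A M n ∧ ∃ v ∈ invCochain k A M G n,
      v ∈ cocycles k A M n ∧ (deltaC ρ n ^ i) w - (deltaC ρ n ^ (i + 1)) w' - v ∈
        boundaries (fixedCochain k A M H) n) ↔
    (deltaC ρ n ^ (p ^ e - 1)) w ∈
      (boundaries (fixedCochain k A M H) n).map (deltaC ρ n ^ (p ^ e - 1 - i)) := by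
  constructor
  · rintro ⟨w', hw', -, v, hv, -, hy⟩
    refine ⟨_, hy, ?_⟩
    -- Apply `Δ^{q-1-i}` to the given relation: the exponent is positive, so `v` dies, and the term
    -- in `w'` acquires `Δ^q = 0`.
    have hv₀ : (deltaC ρ n ^ (p ^ e - 1 - i)) v = 0 := by
      rw [show p ^ e - 1 - i = p ^ e - 2 - i + 1 by omega, pow_succ, Module.End.mul_apply,
        (D.mem_invCochain_iff.1 hv).2, map_zero]
    rw [map_sub, map_sub, hv₀, sub_zero, ← Module.End.mul_apply, ← Module.End.mul_apply, ← pow_add,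
      ← pow_add, show p ^ e - 1 - i + i = p ^ e - 1 by omega,
      show p ^ e - 1 - i + (i + 1) = p ^ e by omega, D.deltaC_pow_eq_zero hw', sub_zero]
  · rintro ⟨y, hy, hyw⟩
    have hyB := boundaries_fixedCochain_le H n hy
    -- By freeness `Δ^i w - y = Δ^{i+1} w₀`, but `w₀` need not be a cocycle.
    have h₁ : (deltaC ρ n ^ (p ^ e - 1 - i)) ((deltaC ρ n ^ i) w - y) = 0 := by
      rw [map_sub, hyw, ← Module.End.mul_apply, ← pow_add,
        show p ^ e - 1 - i + i = p ^ e - 1 by omega, sub_self]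
    obtain ⟨w₀, hw₀, hyw₀⟩ := D.exists_deltaC_pow_eq (by omega)
      (Submodule.sub_mem _ (deltaC_pow_mem_fixedCochain ρ i hw) hyB) h₁
    rw [show p ^ e - (p ^ e - 1 - i) = i + 1 by omega] at hyw₀
    have h₂ : (deltaC ρ n ^ (i + 2)) w₀ = (deltaC ρ n ^ (i + 1)) w - deltaC ρ n y := by
      rw [pow_succ', Module.End.mul_apply, hyw₀, map_sub, ← Module.End.mul_apply, ← pow_succ']
    have h₃ : (deltaC ρ n ^ (i + 1)) w - deltaC ρ n y ∈ boundaries (fixedCochain k A M H) n :=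
      Submodule.sub_mem _ hwi (by simpa using deltaC_pow_mem_boundaries ρ 1 hy)
    -- One more `Δ` lands in `B`, so a cocycle `w'` with the same `Δ^{i+2}` exists. The resulting
    -- error `Δ^i w - Δ^{i+1} w' - y` is killed by `Δ`, hence invariant, and serves as `v`.
    obtain ⟨w', hw', hwc', hww'⟩ := D.exists_cocycle_of_mem_boundaries hi h₃ hw₀ h₂
    refine ⟨w', hw', hwc', (deltaC ρ n ^ i) w - (deltaC ρ n ^ (i + 1)) w' - y,
      D.mem_invCochain_iff.2 ⟨Submodule.sub_mem _ (Submodule.sub_mem _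
        (deltaC_pow_mem_fixedCochain ρ i hw) (deltaC_pow_mem_fixedCochain ρ _ hw')) hyB, ?_⟩,
      Submodule.sub_mem _ (Submodule.sub_mem _ (deltaC_pow_mem_cocycles ρ i hwc)
        (deltaC_pow_mem_cocycles ρ _ hwc')) (boundaries_le_cocycles _ n hy), ?_⟩
    · rw [map_sub, map_sub, ← Module.End.mul_apply, ← pow_succ', ← Module.End.mul_apply, ← pow_succ',
        hww']
      abel
    · rw [sub_sub_cancel]
      exact hy

end NormData

end Boundaries

/-! ### Isomorphisms of graded bimodules obtained from a common cover -/

section Correspondence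

variable {k : Type*} [Field k] {R V W Z : ℕ → Type*}
  [∀ n, AddCommGroup (R n)] [∀ n, Module k (R n)]
  [∀ n, AddCommGroup (V n)] [∀ n, Module k (V n)]
  [∀ n, AddCommGroup (W n)] [∀ n, Module k (W n)]
  [∀ n, AddCommGroup (Z n)] [∀ n, Module k (Z n)]
  {P : GradedAction k R V} {Q : GradedAction k R W}

/-- Two graded bimodules that are images of `Z` under maps with the same kernel are isomorphic. -/
theorem GradedAction.Iso.of_ker_eq (f : ∀ n, Z n →ₗ[k] V n) (g : ∀ n, Z n →ₗ[k] W n)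
    (hf : ∀ n, Function.Surjective (f n)) (hg : ∀ n, Function.Surjective (g n))
    (hfg : ∀ n z, f n z = 0 ↔ g n z = 0)
    (hl : ∀ m n (b : R m) (z : Z n), ∃ z', f (m + n) z' = P.left m n b (f n z) ∧
      g (m + n) z' = Q.left m n b (g n z))
    (hr : ∀ m n (b : R m) (z : Z n), ∃ z', f (n + m) z' = P.right m n b (f n z) ∧
      g (n + m) z' = Q.right m n b (g n z)) : Nonempty (P.Iso Q) := by
  let E : ∀ n, V n ≃ₗ[k] W n := fun n =>
    ((f n).quotKerEquivOfSurjective (hf n)).symm ≪≫ₗ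
      (Submodule.quotEquivOfEq (LinearMap.ker (f n)) (LinearMap.ker (g n))
        (Submodule.ext fun z => hfg n z) ≪≫ₗ
        (g n).quotKerEquivOfSurjective (hg n))
  have hE : ∀ n z, E n (f n z) = g n z := by
    intro n z
    have h : ((f n).quotKerEquivOfSurjective (hf n)).symm (f n z) = Submodule.Quotient.mk z := by
      rw [LinearEquiv.symm_apply_eq]
      rfl
    simp only [E, LinearEquiv.trans_apply, h]
    rfl
  refine ⟨⟨E, fun m n b x => ?_, fun m n b x => ?_⟩⟩
  · obtain ⟨z, rfl⟩ := hf n x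
    -- No action on `Z` is required: a common lift of the two products is enough, which leaves the
    -- choice of a cocycle representing `b` free.
    obtain ⟨z', h₁, h₂⟩ := hl m n b z
    rw [← h₁, hE, hE, h₂]
  · obtain ⟨z, rfl⟩ := hf n x
    obtain ⟨z', h₁, h₂⟩ := hr m n b z
    rw [← h₁, hE, hE, h₂]

/-- The version of `GradedAction.Iso.of_ker_eq` for quotients of subbimodules. -/
theorem GradedAction.Iso.of_range_eq {S S' : ∀ n, Submodule k (V n)} {T T' : ∀ n, Submodule k (W n)}
    (hS : P.IsSubbimodule S) (hS' : P.IsSubbimodule S')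
    (hT : Q.IsSubbimodule T) (hT' : Q.IsSubbimodule T')
    (f : ∀ n, Z n →ₗ[k] V n) (g : ∀ n, Z n →ₗ[k] W n)
    (hf : ∀ n, LinearMap.range (f n) = S n) (hg : ∀ n, LinearMap.range (g n) = T n)
    (hfg : ∀ n z, f n z ∈ S' n ↔ g n z ∈ T' n)
    (hl : ∀ m n (b : R m) (z : Z n), ∃ z', f (m + n) z' = P.left m n b (f n z) ∧
      g (m + n) z' = Q.left m n b (g n z))
    (hr : ∀ m n (b : R m) (z : Z n), ∃ z', f (n + m) z' = P.right m n b (f n z) ∧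
      g (n + m) z' = Q.right m n b (g n z)) :
    Nonempty ((P.quotient hS hS').Iso (Q.quotient hT hT')) := by
  have hf₁ : ∀ n z, f n z ∈ S n := fun n z => hf n ▸ ⟨z, rfl⟩
  have hg₁ : ∀ n z, g n z ∈ T n := fun n z => hg n ▸ ⟨z, rfl⟩
  refine GradedAction.Iso.of_ker_eq
    (fun n => Subquot.mk (S n) (S' n) ∘ₗ (f n).codRestrict (S n) (hf₁ n))
    (fun n => Subquot.mk (T n) (T' n) ∘ₗ (g n).codRestrict (T n) (hg₁ n)) ?_ ?_ ?_ ?_ ?_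
  · intro n
    refine (Subquot.mk_surjective _ _).comp ?_
    rintro ⟨x, hx⟩
    rw [← hf n] at hx
    obtain ⟨z, rfl⟩ := hx
    exact ⟨z, rfl⟩
  · intro n
    refine (Subquot.mk_surjective _ _).comp ?_
    rintro ⟨x, hx⟩
    rw [← hg n] at hx
    obtain ⟨z, rfl⟩ := hx
    exact ⟨z, rfl⟩
  · intro n z
    exact (Subquot.mk_eq_zero _).trans ((hfg n z).trans
      (Subquot.mk_eq_zero (⟨g n z, hg₁ n z⟩ : T n)).symm)
  · intro m n b z
    obtain ⟨z', h₁, h₂⟩ := hl m n b z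
    exact ⟨z', congrArg (Subquot.mk _ _) (Subtype.ext h₁), congrArg (Subquot.mk _ _) (Subtype.ext h₂)⟩
  · intro m n b z
    obtain ⟨z', h₁, h₂⟩ := hr m n b z
    exact ⟨z', congrArg (Subquot.mk _ _) (Subtype.ext h₁), congrArg (Subquot.mk _ _) (Subtype.ext h₂)⟩

end Correspondence

/-! ### The filtrations of `X` and `Y`, and their common cover by cocycles -/

section Classes

variable {k A M G : Type*} [Field k] [Ring A] [Algebra k A] [Ring M] [Algebra k M]
  [Module A M] [Module Aᵐᵒᵖ M] [SMulCommClass A Aᵐᵒᵖ M]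
  [IsScalarTower k A M] [IsScalarTower k Aᵐᵒᵖ M]
  [Group G] [MulSemiringAction G A] [SMulCommClass G k A]
  [MulSemiringAction G M] [SMulCommClass G k M] [hM : IsAeGModuleAlgebra k A M G]

variable (k A M) in
/-- The class of a cocycle in `HH^n(A, M)`. -/
abbrev toHH (n : ℕ) : cocycles k A M n →ₗ[k] HH k A M n := Subquot.mk _ _

variable (k A M G) in
/-- The class of an invariant cocycle in `HH^n(A, M)^{G↑}`. -/
abbrev toHHup (n : ℕ) : ↥(cocycles k A M n ⊓ invCochain k A M G n) →ₗ[k] HHup k A M G n :=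
  Subquot.mk _ _

theorem toHH_mem_invHH {H : Subgroup G} {n : ℕ} {w : Cochain k A M n} (hwc : w ∈ cocycles k A M n)
    (hw : w ∈ fixedCochain k A M H n) : toHH k A M n ⟨w, hwc⟩ ∈ invHH k A M G H n := fun g hg =>
  congrArg (toHH k A M n) (Subtype.ext (hw g hg))

/-- Invariance of the class means that each `g f - f` with `g ∈ H` is a coboundary, so the average
of a representative `f` stays in the class. -/
theorem exists_fixed_cocycle {H : Subgroup G} [Finite H] (hH : (Nat.card H : k) ≠ 0) {n : ℕ}
    {x : HH k A M n} (hx : x ∈ invHH k A M G H n) :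
    ∃ w, ∃ hwc : w ∈ cocycles k A M n, w ∈ fixedCochain k A M H n ∧ toHH k A M n ⟨w, hwc⟩ = x := by
  obtain ⟨⟨f, hf⟩, rfl⟩ := Subquot.mk_surjective _ _ x
  have hb : average k A M H n f - f ∈ boundaries (fun _ => ⊤) n :=
    average_sub_mem H hH fun g hg => by
      have h := sub_eq_zero.2 (hx g hg)
      rw [actHH, Subquot.map_mk, ← map_sub] at h
      exact (Subquot.mk_eq_zero _).1 h
  have hc : average k A M H n f ∈ cocycles k A M n := by
    simpa using Submodule.add_mem _ (boundaries_le_cocycles _ n hb) hf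
  refine ⟨_, hc, average_mem_fixedCochain H n f, ?_⟩
  rw [← sub_eq_zero, ← map_sub]
  exact (Subquot.mk_eq_zero _).2 hb

theorem DeltaHH_pow_toHH (ρ : G) (j : ℕ) {n : ℕ} {w : Cochain k A M n}
    (hw : w ∈ cocycles k A M n) : (DeltaHH k A M G ρ n ^ j) (toHH k A M n ⟨w, hw⟩) =
      toHH k A M n ⟨(deltaC ρ n ^ j) w, deltaC_pow_mem_cocycles ρ j hw⟩ := by
  induction j with
  | zero => rfl
  | succ j ih =>
    rw [pow_succ', Module.End.mul_apply, ih, DeltaHH, LinearMap.sub_apply, Module.End.one_apply,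
      actHH, Subquot.map_mk, ← map_sub]
    exact congrArg (toHH k A M n) (Subtype.ext (LinearMap.congr_fun
      (pow_succ' (deltaC ρ n) j).symm w))

omit [SMulCommClass A Aᵐᵒᵖ M] hM in
theorem mem_imTheta_iff {n : ℕ} {x : HH k A M n} : x ∈ imTheta k A M G n ↔
    ∃ v, ∃ hv : v ∈ cocycles k A M n, v ∈ invCochain k A M G n ∧ toHH k A M n ⟨v, hv⟩ = x := by
  constructor
  · rintro ⟨y, rfl⟩
    obtain ⟨⟨v, hv⟩, rfl⟩ := Subquot.mk_surjective _ _ y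
    exact ⟨v, hv.1, hv.2, rfl⟩
  · rintro ⟨v, hv, hv', rfl⟩
    exact ⟨toHHup k A M G n ⟨v, hv, hv'⟩, rfl⟩

omit [SMulCommClass A Aᵐᵒᵖ M] hM in
theorem exists_toImTheta_eq {n : ℕ} (b : imTheta k A M G n) :
    ∃ v, ∃ hv : v ∈ cocycles k A M n ⊓ invCochain k A M G n,
      toImTheta k A M G n (toHHup k A M G n ⟨v, hv⟩) = b := by
  obtain ⟨_, y, rfl⟩ := b
  obtain ⟨⟨v, hv⟩, rfl⟩ := Subquot.mk_surjective _ _ y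
  exact ⟨v, hv, rfl⟩

omit [SMulCommClass A Aᵐᵒᵖ M] hM in
theorem toHHup_mem_kerTheta_iff {n : ℕ} {x : Cochain k A M n}
    {hx : x ∈ cocycles k A M n ⊓ invCochain k A M G n} :
    toHHup k A M G n ⟨x, hx⟩ ∈ kerTheta k A M G n ↔ x ∈ boundaries (fun _ => ⊤) n :=
  (LinearMap.mem_ker).trans (Subquot.mk_eq_zero _)

variable (k A M G) in
-- A linear section of `Θ` over its image defines the products; since `X` has square zero, replacing
-- the chosen lift of `Θ(b)` by `b` does not change them.
theorem exists_isKerAction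
    (hX : ∀ (n r : ℕ) (x : kerTheta k A M G n) (y : kerTheta k A M G r),
      cupUp k A M G n r x y = 0) :
    ∃ P : GradedAction k (fun n => imTheta k A M G n) (fun n => kerTheta k A M G n),
      IsKerAction k A M G P := by
  have hs : ∀ n, ∃ s : imTheta k A M G n →ₗ[k] HHup k A M G n,
      toImTheta k A M G n ∘ₗ s = LinearMap.id := fun n =>
    LinearMap.exists_rightInverse_of_surjective _ (LinearMap.range_rangeRestrict _)
  choose s hs using hs
  have hker : ∀ n (b : HHup k A M G n), b - s n (toImTheta k A M G n b) ∈ kerTheta k A M G n := by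
    intro n b
    have h := congrArg Subtype.val (LinearMap.congr_fun (hs n) (toImTheta k A M G n b))
    exact LinearMap.mem_ker.2 (by rw [map_sub, sub_eq_zero]; exact h.symm)
  have hl : ∀ m n (b : HHup k A M G m) (x : kerTheta k A M G n),
      cupUp k A M G m n b x ∈ kerTheta k A M G (m + n) := by
    intro m n b x
    rw [kerTheta, LinearMap.mem_ker, Theta_cupUp, LinearMap.mem_ker.1 x.2, map_zero]
  have hr : ∀ m n (b : HHup k A M G m) (x : kerTheta k A M G n),
      cupUp k A M G n m x b ∈ kerTheta k A M G (n + m) := by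
    intro m n b x
    rw [kerTheta, LinearMap.mem_ker, Theta_cupUp, LinearMap.mem_ker.1 x.2, map_zero,
      LinearMap.zero_apply]
  refine ⟨⟨fun m n => LinearMap.mk₂ k (fun b x => ⟨cupUp k A M G m n (s m b) x, hl m n _ x⟩)
      (fun b b' x => Subtype.ext (by simp)) (fun c b x => Subtype.ext (by simp))
      (fun b x x' => Subtype.ext (by simp)) (fun c b x => Subtype.ext (by simp)),
    fun m n => LinearMap.mk₂ k (fun b x => ⟨cupUp k A M G n m x (s m b), hr m n _ x⟩)
      (fun b b' x => Subtype.ext (by simp)) (fun c b x => Subtype.ext (by simp))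
      (fun b x x' => Subtype.ext (by simp)) (fun c b x => Subtype.ext (by simp))⟩,
    fun m n b x => ⟨?_, ?_⟩⟩
  · have h := hX m n ⟨_, hker m b⟩ x
    rw [map_sub, LinearMap.sub_apply, sub_eq_zero] at h
    exact h.symm
  · have h := hX n m x ⟨_, hker m b⟩
    rw [map_sub, sub_eq_zero] at h
    exact h.symm

theorem DeltaHH_pow_cupHH_right (ρ : G) (j : ℕ) {n r : ℕ} {x : HH k A M n} {y : HH k A M r}
    (hx : actHH k A M G ρ n x = x) : (DeltaHH k A M G ρ (n + r) ^ j) (cupHH k A M G n r x y) =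
      cupHH k A M G n r x ((DeltaHH k A M G ρ r ^ j) y) := by
  induction j with
  | zero => rfl
  | succ j ih =>
    rw [pow_succ', Module.End.mul_apply, ih, pow_succ', Module.End.mul_apply]
    simp only [DeltaHH, LinearMap.sub_apply, Module.End.one_apply, actHH_cupHH, hx, map_sub]

theorem DeltaHH_pow_cupHH_left (ρ : G) (j : ℕ) {n r : ℕ} {x : HH k A M n} {y : HH k A M r}
    (hy : actHH k A M G ρ r y = y) : (DeltaHH k A M G ρ (n + r) ^ j) (cupHH k A M G n r x y) =
      cupHH k A M G n r ((DeltaHH k A M G ρ n ^ j) x) y := by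
  induction j with
  | zero => rfl
  | succ j ih =>
    rw [pow_succ', Module.End.mul_apply, ih, pow_succ', Module.End.mul_apply]
    simp only [DeltaHH, LinearMap.sub_apply, Module.End.one_apply, actHH_cupHH, hy, map_sub]

theorem cupHH_mem_invHH_of_subgroup {H : Subgroup G} {n r : ℕ} {x : HH k A M n} {y : HH k A M r}
    (hx : x ∈ invHH k A M G H n) (hy : y ∈ invHH k A M G H r) :
    cupHH k A M G n r x y ∈ invHH k A M G H (n + r) := fun g hg => by
  rw [actHH_cupHH, hx g hg, hy g hg]

theorem invHH_top_le (H : Subgroup G) (n : ℕ) : invHH k A M G ⊤ n ≤ invHH k A M G H n :=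
  fun _ hx g _ => hx g trivial

variable (k A M) in
/-- The filtration of `X = Ker Θ` by the classes that bound in `Δ^l C(A, M)^H`. -/
def kerFiltration (H : Subgroup G) (ρ : G) (l n : ℕ) : Submodule k (kerTheta k A M G n) :=
  Submodule.comap (kerTheta k A M G n).subtype (Submodule.map (toHHup k A M G n)
    (Submodule.comap (Submodule.subtype _)
      ((boundaries (fixedCochain k A M H) n).map (deltaC ρ n ^ l))))

variable (k A M) in
/-- The filtration of `Y = Coker Θ` induced by `Δ^i HH^*(A, M)^H`. -/
def cokerFiltration (H : Subgroup G) (ρ : G) (i n : ℕ) : Submodule k (cokerTheta k A M G n) :=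
  Submodule.map (Subquot.mk _ _) (Submodule.comap (invHH k A M G ⊤ n).subtype
    ((invHH k A M G H n).map (DeltaHH k A M G ρ n ^ i)))

theorem map_deltaC_pow_boundaries_le (H : Subgroup G) [H.Normal] (ρ : G) (l n : ℕ) :
    (boundaries (fixedCochain k A M H) n).map (deltaC ρ n ^ (l + 1)) ≤
      (boundaries (fixedCochain k A M H) n).map (deltaC ρ n ^ l) := by
  rintro _ ⟨y, hy, rfl⟩
  refine ⟨deltaC ρ n y, by simpa using deltaC_pow_mem_boundaries ρ 1 hy, ?_⟩
  rw [pow_succ, Module.End.mul_apply]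

theorem kerFiltration_succ_le (H : Subgroup G) [H.Normal] (ρ : G) (l n : ℕ) :
    kerFiltration k A M H ρ (l + 1) n ≤ kerFiltration k A M H ρ l n :=
  Submodule.comap_mono (Submodule.map_mono (Submodule.comap_mono
    (map_deltaC_pow_boundaries_le H ρ l n)))

theorem kerFiltration_zero {H : Subgroup G} [Finite H] (hH : (Nat.card H : k) ≠ 0) (ρ : G) (n : ℕ) :
    kerFiltration k A M H ρ 0 n = ⊤ := by
  rw [eq_top_iff]
  rintro ⟨x, hx⟩ -
  obtain ⟨⟨f, hf⟩, rfl⟩ := Subquot.mk_surjective _ _ x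
  exact ⟨⟨f, hf⟩, ⟨f, mem_boundaries_fixedCochain H hH (fun g _ => hf.2 g)
    (toHHup_mem_kerTheta_iff.1 hx), rfl⟩, rfl⟩

/-- For an invariant cocycle `v`, `v ⌣ Δ^l y = Δ^l (v ⌣ y)`, and `v ⌣ y` is again in `B` if `y` is;
likewise on the right. -/
theorem isSubbimodule_kerFiltration (H : Subgroup G) (ρ : G) (l : ℕ)
    {P : GradedAction k (fun n => imTheta k A M G n) (fun n => kerTheta k A M G n)}
    (hP : IsKerAction k A M G P) : P.IsSubbimodule (kerFiltration k A M H ρ l) := by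
  rintro r n b x ⟨⟨_, hf⟩, ⟨y, hy, rfl⟩, hfx⟩
  obtain ⟨v, hv, rfl⟩ := exists_toImTheta_eq b
  have hvH : v ∈ fixedCochain k A M H r := fun g _ => hv.2 g
  change toHHup k A M G n _ = (x : HHup k A M G n) at hfx
  constructor
  · change (P.left r n (toImTheta k A M G r _) x : HHup k A M G (r + n)) ∈ Submodule.map _ _
    rw [(hP r n _ x).1, ← hfx]
    refine ⟨_, ⟨cup r n v y, ?_, deltaC_pow_cup_right ρ l (hv.2 ρ)⟩, rfl⟩
    exact cup_mem_boundaries_right hM.smul_mul hM.mul_op_smul hM.op_smul_mul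
      (fun j t ht => cup_mem_fixedCochain hvH ht) hv.1 hy
  · change (P.right r n (toImTheta k A M G r _) x : HHup k A M G (n + r)) ∈ Submodule.map _ _
    rw [(hP r n _ x).2, ← hfx]
    refine ⟨_, ⟨cup n r y v, ?_, deltaC_pow_cup_left ρ l (hv.2 ρ)⟩, rfl⟩
    exact cup_mem_boundaries_left hM.smul_mul hM.mul_op_smul hM.op_smul_mul
      (fun j t ht => cup_mem_fixedCochain ht hvH) hy hv.1

theorem DeltaHH_mem_invHH {H : Subgroup G} [H.Normal] (ρ : G) {n : ℕ} {x : HH k A M n}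
    (hx : x ∈ invHH k A M G H n) : DeltaHH k A M G ρ n x ∈ invHH k A M G H n := by
  have hmul : ∀ (g g' : G) (y : HH k A M n),
      actHH k A M G g n (actHH k A M G g' n y) = actHH k A M G (g * g') n y := by
    intro g g' y
    obtain ⟨f, rfl⟩ := Subquot.mk_surjective _ _ y
    simp only [actHH, Subquot.map_mk, act_mul, Module.End.mul_apply]
  refine Submodule.sub_mem _ hx fun g hg => ?_
  have h := hx (ρ⁻¹ * g * ρ) (by simpa using ‹H.Normal›.conj_mem g hg ρ⁻¹)
  conv_rhs => rw [← h]
  rw [hmul, hmul]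
  congr 2
  group

theorem cokerFiltration_succ_le (H : Subgroup G) [H.Normal] (ρ : G) (i n : ℕ) :
    cokerFiltration k A M H ρ (i + 1) n ≤ cokerFiltration k A M H ρ i n := by
  refine Submodule.map_mono (Submodule.comap_mono ?_)
  rintro _ ⟨y, hy, rfl⟩
  refine ⟨_, DeltaHH_mem_invHH ρ hy, ?_⟩
  rw [pow_succ, Module.End.mul_apply]

theorem cokerFiltration_zero (H : Subgroup G) (ρ : G) (n : ℕ) :
    cokerFiltration k A M H ρ 0 n = ⊤ := by
  rw [eq_top_iff]
  rintro x -
  obtain ⟨y, rfl⟩ := Subquot.mk_surjective _ _ x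
  exact ⟨y, ⟨y, invHH_top_le H n y.2, rfl⟩, rfl⟩

theorem isSubbimodule_cokerFiltration (H : Subgroup G) (ρ : G) (i : ℕ) :
    (cokerAction k A M G).IsSubbimodule (cokerFiltration k A M H ρ i) := by
  rintro r n b _ ⟨⟨_, hf⟩, ⟨y, hy, rfl⟩, rfl⟩
  have hb := imTheta_le_invHH k A M G r b.2
  constructor
  · exact ⟨_, ⟨cupHH k A M G r n b y, cupHH_mem_invHH_of_subgroup (invHH_top_le H r hb) hy,
      DeltaHH_pow_cupHH_right ρ i (hb ρ trivial)⟩, rfl⟩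
  · exact ⟨_, ⟨cupHH k A M G n r y b, cupHH_mem_invHH_of_subgroup hy (invHH_top_le H r hb),
      DeltaHH_pow_cupHH_left ρ i (hb ρ trivial)⟩, rfl⟩

variable (k A M) in
/-- The `H`-invariant cocycles `w` such that `Δ^{i+1} w` is a coboundary. -/
def deltaTorsionCocycles (H : Subgroup G) (ρ : G) (i n : ℕ) : Submodule k (Cochain k A M n) :=
  (cocycles k A M n ⊓ fixedCochain k A M H n) ⊓
    (boundaries (fixedCochain k A M H) n).comap (deltaC ρ n ^ (i + 1))

theorem cup_mem_deltaTorsionCocycles_right {H : Subgroup G} {ρ : G} {i n r : ℕ}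
    {v : Cochain k A M r} (hv : v ∈ cocycles k A M r ⊓ invCochain k A M G r)
    {w : Cochain k A M n} (hw : w ∈ deltaTorsionCocycles k A M H ρ i n) :
    cup r n v w ∈ deltaTorsionCocycles k A M H ρ i (r + n) := by
  have hvH : v ∈ fixedCochain k A M H r := fun g _ => hv.2 g
  refine ⟨⟨cup_mem_cocycles hM.smul_mul hM.mul_op_smul hM.op_smul_mul hv.1 hw.1.1,
    cup_mem_fixedCochain hvH hw.1.2⟩, ?_⟩
  change (deltaC ρ (r + n) ^ (i + 1)) (cup r n v w) ∈ boundaries (fixedCochain k A M H) _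
  rw [deltaC_pow_cup_right ρ _ (hv.2 ρ)]
  exact cup_mem_boundaries_right hM.smul_mul hM.mul_op_smul hM.op_smul_mul
    (fun j t ht => cup_mem_fixedCochain hvH ht) hv.1 hw.2

theorem cup_mem_deltaTorsionCocycles_left {H : Subgroup G} {ρ : G} {i n r : ℕ}
    {v : Cochain k A M r} (hv : v ∈ cocycles k A M r ⊓ invCochain k A M G r)
    {w : Cochain k A M n} (hw : w ∈ deltaTorsionCocycles k A M H ρ i n) :
    cup n r w v ∈ deltaTorsionCocycles k A M H ρ i (n + r) := by
  have hvH : v ∈ fixedCochain k A M H r := fun g _ => hv.2 g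
  refine ⟨⟨cup_mem_cocycles hM.smul_mul hM.mul_op_smul hM.op_smul_mul hw.1.1 hv.1,
    cup_mem_fixedCochain hw.1.2 hvH⟩, ?_⟩
  change (deltaC ρ (n + r) ^ (i + 1)) (cup n r w v) ∈ boundaries (fixedCochain k A M H) _
  rw [deltaC_pow_cup_left ρ _ (hv.2 ρ)]
  exact cup_mem_boundaries_left hM.smul_mul hM.mul_op_smul hM.op_smul_mul
    (fun j t ht => cup_mem_fixedCochain ht hvH) hw.2 hv.1

namespace NormData

variable {H : Subgroup G} {ρ : G} {p e : ℕ} {m : M} {h : A →ₗ[k] M}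

/-- `G` is generated by `H` and `ρ`: modulo coboundaries `ρ^j w - w` telescopes into translates of
`Δ w`. -/
theorem toHH_mem_invHH_top (D : NormData k A M H ρ p e m h) {n : ℕ} {w : Cochain k A M n}
    (hwc : w ∈ cocycles k A M n) (hw : w ∈ fixedCochain k A M H n)
    (hρ : deltaC ρ n w ∈ boundaries (fun _ => ⊤) n) :
    toHH k A M n ⟨w, hwc⟩ ∈ invHH k A M G ⊤ n := by
  intro g hg
  clear hg
  obtain ⟨j, x, hx, rfl⟩ := D.exists_pow_mul g
  rw [actHH, Subquot.map_mk, ← sub_eq_zero, ← map_sub]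
  refine (Subquot.mk_eq_zero _).2 ?_
  change act (ρ ^ j * x) n w - w ∈ _
  rw [act_mul, Module.End.mul_apply, hw x hx]
  induction j with
  | zero => simp [act_one]
  | succ j ih =>
    have h : act (ρ ^ (j + 1)) n w - w =
        (act (ρ ^ j) n w - w) - act (ρ ^ j) n (deltaC ρ n w) := by
      rw [pow_succ, act_mul, Module.End.mul_apply, deltaC_apply, map_sub]
      abel
    rw [h]
    exact Submodule.sub_mem _ ih (act_mem_boundaries _ hρ)

variable [Fact p.Prime] [CharP k p] [H.Normal]

theorem cupUp_kerTheta (D : NormData k A M H ρ p e m h) [Finite H] (hH : (Nat.card H : k) ≠ 0)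
    (n r : ℕ) (x : kerTheta k A M G n) (y : kerTheta k A M G r) : cupUp k A M G n r x y = 0 := by
  obtain ⟨x, hx⟩ := x
  obtain ⟨y, hy⟩ := y
  obtain ⟨⟨f, hf⟩, rfl⟩ := Subquot.mk_surjective _ _ x
  obtain ⟨⟨g, hg⟩, rfl⟩ := Subquot.mk_surjective _ _ y
  refine (Subquot.mk_eq_zero _).2 (D.cup_mem_boundaries_invCochain hf.2 ?_ hg.2 ?_)
  · exact mem_boundaries_fixedCochain H hH (fun g _ => hf.2 g) (toHHup_mem_kerTheta_iff.1 hx)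
  · exact mem_boundaries_fixedCochain H hH (fun α _ => hg.2 α) (toHHup_mem_kerTheta_iff.1 hy)

/-- The condition does not depend on the representative: two of them differ by an element of `δ(C^G)
= Δ^{q-1} B`, which is contained in `Δ^l B` for `l ≤ q - 1`. -/
theorem mem_kerFiltration_iff (D : NormData k A M H ρ p e m h) {l n : ℕ} (hl : l < p ^ e)
    {x : Cochain k A M n} {hx : x ∈ cocycles k A M n ⊓ invCochain k A M G n}
    {hx' : toHHup k A M G n ⟨x, hx⟩ ∈ kerTheta k A M G n} :
    (⟨toHHup k A M G n ⟨x, hx⟩, hx'⟩ : kerTheta k A M G n) ∈ kerFiltration k A M H ρ l n ↔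
      x ∈ (boundaries (fixedCochain k A M H) n).map (deltaC ρ n ^ l) := by
  refine ⟨?_, fun h => ⟨⟨x, hx⟩, h, rfl⟩⟩
  rintro ⟨⟨y, hy⟩, hyl, hxy⟩
  have h₁ := sub_eq_zero.2 hxy
  change toHHup k A M G n ⟨y, hy⟩ - toHHup k A M G n ⟨x, hx⟩ = 0 at h₁
  rw [← map_sub] at h₁
  have h₂ : y - x ∈ boundaries (invCochain k A M G) n := (Subquot.mk_eq_zero _).1 h₁
  rw [D.boundaries_invCochain] at h₂
  have h₃ : ∀ a, (boundaries (fixedCochain k A M H) n).map (deltaC ρ n ^ (l + a)) ≤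
      (boundaries (fixedCochain k A M H) n).map (deltaC ρ n ^ l) := by
    intro a
    induction a with
    | zero => exact le_rfl
    | succ a ih => exact (map_deltaC_pow_boundaries_le H ρ (l + a) n).trans ih
  have h₄ := h₃ (p ^ e - 1 - l) ((show p ^ e - 1 = l + (p ^ e - 1 - l) by omega) ▸ h₂)
  rw [← sub_sub_cancel y x]
  exact Submodule.sub_mem _ hyl h₄

theorem kerFiltration_last (D : NormData k A M H ρ p e m h) (n : ℕ) :
    kerFiltration k A M H ρ (p ^ e - 1) n = ⊥ := by
  rw [eq_bot_iff]
  rintro ⟨x, hx⟩ hxl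
  obtain ⟨⟨f, hf⟩, rfl⟩ := Subquot.mk_surjective _ _ x
  rw [D.mem_kerFiltration_iff (Nat.sub_lt (pow_pos (Fact.out : p.Prime).pos e) one_pos),
    ← D.boundaries_invCochain] at hxl
  exact (Submodule.mem_bot k).2 (Subtype.ext ((Subquot.mk_eq_zero _).2 hxl))

/-- Represent the class by an `H`-fixed cocycle `w`; then `Δ^{q-1} w` is a norm, so an invariant
cocycle, and its class is in the image of `Θ`. -/
theorem cokerFiltration_last (D : NormData k A M H ρ p e m h) [Finite H]
    (hH : (Nat.card H : k) ≠ 0) (n : ℕ) : cokerFiltration k A M H ρ (p ^ e - 1) n = ⊥ := by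
  rw [eq_bot_iff]
  rintro _ ⟨⟨_, hf⟩, ⟨y, hy, rfl⟩, rfl⟩
  obtain ⟨w, hwc, hw, rfl⟩ := exists_fixed_cocycle hH hy
  refine (Submodule.mem_bot k).2 ((Subquot.mk_eq_zero _).2 (mem_imTheta_iff.2 ?_))
  exact ⟨_, _, D.deltaC_pow_sub_one_mem hw, (DeltaHH_pow_toHH ρ _ hwc).symm⟩

/-- The map `w ↦ [Δ^i w]` to `Y`. -/
def torsionToCoker (D : NormData k A M H ρ p e m h) (i n : ℕ) :
    deltaTorsionCocycles k A M H ρ i n →ₗ[k] cokerTheta k A M G n :=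
  Subquot.mk _ _ ∘ₗ (toHH k A M n ∘ₗ
    ((deltaC ρ n ^ i) ∘ₗ (deltaTorsionCocycles k A M H ρ i n).subtype).codRestrict _
      (fun w => deltaC_pow_mem_cocycles ρ i w.2.1.1)).codRestrict _
      (fun w => D.toHH_mem_invHH_top _ (deltaC_pow_mem_fixedCochain ρ i w.2.1.2) (by
        have h := boundaries_mono (fun _ => le_top) n w.2.2
        rwa [pow_succ', Module.End.mul_apply] at h))

/-- The map `w ↦ [Δ^{q-1} w]` to `X`. -/
def torsionToKer (D : NormData k A M H ρ p e m h) (i n : ℕ) (hi : i + 2 ≤ p ^ e) :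
    deltaTorsionCocycles k A M H ρ i n →ₗ[k] kerTheta k A M G n :=
  (toHHup k A M G n ∘ₗ
    ((deltaC ρ n ^ (p ^ e - 1)) ∘ₗ (deltaTorsionCocycles k A M H ρ i n).subtype).codRestrict _
      (fun w => ⟨deltaC_pow_mem_cocycles ρ _ w.2.1.1, D.deltaC_pow_sub_one_mem w.2.1.2⟩)).codRestrict
      _ (fun w => toHHup_mem_kerTheta_iff.2 (boundaries_mono (fun _ => le_top) n (by
        have h := deltaC_pow_mem_boundaries ρ (p ^ e - 2 - i) w.2.2
        rwa [← Module.End.mul_apply, ← pow_add,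
          show p ^ e - 2 - i + (i + 1) = p ^ e - 1 by omega] at h)))

omit [Fact p.Prime] [CharP k p] in
theorem range_torsionToCoker (D : NormData k A M H ρ p e m h) [Finite H]
    (hH : (Nat.card H : k) ≠ 0) (i n : ℕ) :
    LinearMap.range (D.torsionToCoker i n) = cokerFiltration k A M H ρ i n := by
  apply le_antisymm
  · rintro _ ⟨w, rfl⟩
    exact ⟨_, ⟨_, toHH_mem_invHH w.2.1.1 w.2.1.2, DeltaHH_pow_toHH ρ i w.2.1.1⟩, rfl⟩
  · rintro _ ⟨⟨_, hf⟩, ⟨y, hy, rfl⟩, rfl⟩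
    obtain ⟨w, hwc, hw, rfl⟩ := exists_fixed_cocycle hH hy
    -- That `ρ` fixes the class of `Δ^i w` says exactly that `Δ^{i+1} w` is a coboundary.
    have hρ := hf ρ trivial
    rw [DeltaHH_pow_toHH, eq_comm, ← sub_eq_zero] at hρ
    have hρ' : (deltaC ρ n ^ (i + 1)) w ∈ boundaries (fun _ => ⊤) n := by
      rw [pow_succ', Module.End.mul_apply]
      rw [actHH, Subquot.map_mk, ← map_sub] at hρ
      exact (Subquot.mk_eq_zero _).1 hρ
    refine ⟨⟨w, ⟨hwc, hw⟩, mem_boundaries_fixedCochain H hH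
      (deltaC_pow_mem_fixedCochain ρ _ hw) hρ'⟩, ?_⟩
    exact congrArg (Subquot.mk _ _) (Subtype.ext (DeltaHH_pow_toHH ρ i hwc).symm)

theorem range_torsionToKer (D : NormData k A M H ρ p e m h) (i n : ℕ) (hi : i + 2 ≤ p ^ e) :
    LinearMap.range (D.torsionToKer i n hi) = kerFiltration k A M H ρ (p ^ e - 2 - i) n := by
  apply le_antisymm
  · rintro _ ⟨w, rfl⟩
    refine (D.mem_kerFiltration_iff (by omega)).2 ⟨_, w.2.2, ?_⟩
    change _ = (deltaC ρ n ^ (p ^ e - 1)) (w : Cochain k A M n)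
    rw [← Module.End.mul_apply, ← pow_add, show p ^ e - 2 - i + (i + 1) = p ^ e - 1 by omega]
  · rintro ⟨x, hx⟩ hxl
    obtain ⟨⟨f, hf⟩, rfl⟩ := Subquot.mk_surjective _ _ x
    rw [D.mem_kerFiltration_iff (by omega)] at hxl
    obtain ⟨w, hw, hwc, hwb, hwf⟩ := D.exists_cocycle_of_mem_map (by omega) hf.2 hxl
    rw [show p ^ e - 1 - (p ^ e - 2 - i) = i + 1 by omega] at hwb
    exact ⟨⟨w, ⟨hwc, hw⟩, hwb⟩, Subtype.ext (congrArg (toHHup k A M G n) (Subtype.ext hwf))⟩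

/-- `deltaC_pow_mem_map_iff` read on classes: `w'` represents an element of `HH^H`, and `v`
represents an element of the image of `Θ`. -/
theorem torsionToCoker_mem_iff (D : NormData k A M H ρ p e m h) [Finite H]
    (hH : (Nat.card H : k) ≠ 0) (i n : ℕ) (hi : i + 2 ≤ p ^ e)
    (w : deltaTorsionCocycles k A M H ρ i n) :
    D.torsionToCoker i n w ∈ cokerFiltration k A M H ρ (i + 1) n ↔
      D.torsionToKer i n hi w ∈ kerFiltration k A M H ρ (p ^ e - 1 - i) n := by
  obtain ⟨w, ⟨hwc, hw⟩, hwi⟩ := w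
  refine Iff.trans ?_ ((D.deltaC_pow_mem_map_iff hi hw hwc hwi).trans
    (D.mem_kerFiltration_iff (by omega)).symm)
  constructor
  · rintro ⟨⟨_, hf⟩, ⟨y, hy, rfl⟩, hyw⟩
    obtain ⟨w', hwc', hw', rfl⟩ := exists_fixed_cocycle hH hy
    have h₁ := sub_eq_zero.2 hyw.symm
    rw [torsionToCoker, LinearMap.comp_apply, ← map_sub] at h₁
    obtain ⟨v, hvc, hv, h₂⟩ := mem_imTheta_iff.1 ((Subquot.mk_eq_zero _).1 h₁)
    change _ = toHH k A M n _ - (DeltaHH k A M G ρ n ^ (i + 1)) _ at h₂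
    rw [DeltaHH_pow_toHH, ← map_sub, eq_comm, ← sub_eq_zero, ← map_sub] at h₂
    refine ⟨w', hw', hwc', v, hv, hvc, mem_boundaries_fixedCochain H hH ?_
      ((Subquot.mk_eq_zero _).1 h₂)⟩
    exact Submodule.sub_mem _ (Submodule.sub_mem _ (deltaC_pow_mem_fixedCochain ρ _ hw)
      (deltaC_pow_mem_fixedCochain ρ _ hw')) fun g _ => hv g
  · rintro ⟨w', hw', hwc', v, hv, hvc, hb⟩
    have h₂ : toHH k A M n ⟨_, deltaC_pow_mem_cocycles ρ i hwc⟩ -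
        toHH k A M n ⟨_, deltaC_pow_mem_cocycles ρ (i + 1) hwc'⟩ - toHH k A M n ⟨v, hvc⟩ = 0 := by
      rw [← map_sub, ← map_sub]
      exact (Subquot.mk_eq_zero _).2 (boundaries_mono (fun _ => le_top) n hb)
    -- `Y_{i+1}` only involves `G`-invariant classes; `[Δ^{i+1} w']` is one, being the difference of
    -- `[Δ^i w]` and `[v]`.
    have h₃ : toHH k A M n ⟨_, deltaC_pow_mem_cocycles ρ (i + 1) hwc'⟩ ∈ invHH k A M G ⊤ n := by
      rw [← sub_sub_cancel (toHH k A M n ⟨_, deltaC_pow_mem_cocycles ρ i hwc⟩)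
        (toHH k A M n ⟨_, deltaC_pow_mem_cocycles ρ (i + 1) hwc'⟩), sub_eq_zero.1 h₂]
      refine Submodule.sub_mem _ (D.toHH_mem_invHH_top _ (deltaC_pow_mem_fixedCochain ρ i hw) ?_)
        (toHH_mem_invHH _ fun g _ => hv g)
      have h := boundaries_mono (fun _ => le_top) n hwi
      rwa [pow_succ', Module.End.mul_apply] at h
    refine ⟨⟨_, h₃⟩, ⟨_, toHH_mem_invHH hwc' hw', DeltaHH_pow_toHH ρ _ hwc'⟩, ?_⟩
    rw [eq_comm, ← sub_eq_zero, torsionToCoker, LinearMap.comp_apply, ← map_sub]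
    exact (Subquot.mk_eq_zero _).2 (mem_imTheta_iff.2 ⟨v, hvc, hv, (sub_eq_zero.1 h₂).symm⟩)

variable {P : GradedAction k (fun n => imTheta k A M G n) (fun n => kerTheta k A M G n)}

theorem exists_torsion_left (D : NormData k A M H ρ p e m h) (hP : IsKerAction k A M G P)
    (i : ℕ) (hi : i + 2 ≤ p ^ e) (r n : ℕ) (b : imTheta k A M G r)
    (w : deltaTorsionCocycles k A M H ρ i n) :
    ∃ w', D.torsionToCoker i (r + n) w' = (cokerAction k A M G).left r n b (D.torsionToCoker i n w) ∧
      D.torsionToKer i (r + n) hi w' = P.left r n b (D.torsionToKer i n hi w) := by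
  obtain ⟨v, hv, rfl⟩ := exists_toImTheta_eq b
  refine ⟨⟨_, cup_mem_deltaTorsionCocycles_right hv w.2⟩, ?_, ?_⟩
  · exact congrArg (Subquot.mk _ _) (Subtype.ext (congrArg (toHH k A M _)
      (Subtype.ext (deltaC_pow_cup_right ρ _ (hv.2 ρ)))))
  · refine Subtype.ext ?_
    rw [(hP r n _ _).1]
    exact congrArg (toHHup k A M G _) (Subtype.ext (deltaC_pow_cup_right ρ _ (hv.2 ρ)))

theorem exists_torsion_right (D : NormData k A M H ρ p e m h) (hP : IsKerAction k A M G P)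
    (i : ℕ) (hi : i + 2 ≤ p ^ e) (r n : ℕ) (b : imTheta k A M G r)
    (w : deltaTorsionCocycles k A M H ρ i n) :
    ∃ w', D.torsionToCoker i (n + r) w' = (cokerAction k A M G).right r n b (D.torsionToCoker i n w) ∧
      D.torsionToKer i (n + r) hi w' = P.right r n b (D.torsionToKer i n hi w) := by
  obtain ⟨v, hv, rfl⟩ := exists_toImTheta_eq b
  refine ⟨⟨_, cup_mem_deltaTorsionCocycles_left hv w.2⟩, ?_, ?_⟩
  · exact congrArg (Subquot.mk _ _) (Subtype.ext (congrArg (toHH k A M _)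
      (Subtype.ext (deltaC_pow_cup_left ρ _ (hv.2 ρ)))))
  · refine Subtype.ext ?_
    rw [(hP r n _ _).2]
    exact congrArg (toHHup k A M G _) (Subtype.ext (deltaC_pow_cup_left ρ _ (hv.2 ρ)))

end NormData

end Classes

/-! ### From degeneracy to the theorem, and the case of a single jump -/

section Main

variable {k A M G : Type*} [Field k] [Ring A] [Algebra k A] [Ring M] [Algebra k M]
  [Module A M] [Module Aᵐᵒᵖ M] [SMulCommClass A Aᵐᵒᵖ M]
  [IsScalarTower k A M] [IsScalarTower k Aᵐᵒᵖ M]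
  [Group G] [MulSemiringAction G A] [SMulCommClass G k A]
  [MulSemiringAction G M] [SMulCommClass G k M]

omit [SMulCommClass A Aᵐᵒᵖ M] in
-- Finiteness of `G / H` lets nonnegative powers of `ρ` represent all cosets, and `Δ^{q-1} m = 1`
-- becomes the statement that `m` has norm `1`.
theorem IsDegenerated.normData {p e : ℕ} [Fact p.Prime] [CharP k p] {H : Subgroup G} [H.Normal]
    (hGH : Nat.card (G ⧸ H) = p ^ e) {ρ : G} (hρ : ∀ x : G ⧸ H, x ∈ Subgroup.zpowers (ρ : G ⧸ H))
    {m : M} {h : A →ₗ[k] M} (hdeg : IsDegenerated H ρ (p ^ e) m h) : NormData k A M H ρ p e m h where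
  exists_pow_mul g := by
    have : Finite (G ⧸ H) := Nat.finite_of_card_ne_zero (by
      rw [hGH]
      exact (pow_pos (Fact.out : p.Prime).pos e).ne')
    obtain ⟨j, hj⟩ := (mem_powers_iff_mem_zpowers (y := (g : G ⧸ H))).2 (hρ g)
    exact ⟨j, (ρ ^ j)⁻¹ * g, QuotientGroup.eq.1 hj, by group⟩
  pow_mem := by
    rw [← QuotientGroup.eq_one_iff, QuotientGroup.mk_pow, ← hGH]
    exact pow_card_eq_one'
  m_inv := hdeg.m_inv
  h_inv g hg := LinearMap.ext fun a => hdeg.h_inv g hg a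
  h_der := hdeg.h_der
  norm_m := by
    have hpow : ∀ j : ℕ, (DistribSMul.toLinearMap k M ρ ^ j) m = ρ ^ j • m := by
      intro j
      induction j with
      | zero => simp
      | succ j ih =>
        rw [pow_succ', Module.End.mul_apply, ih, pow_succ', mul_smul]
        rfl
    have hm := hdeg.norm_m
    rw [DeltaM, one_sub_pow_card_sub_one, LinearMap.sum_apply] at hm
    simpa only [hpow] using hm
  delta_h := by
    ext a
    have ha := hdeg.delta_h a
    rw [sub_add_eq_add_sub, sub_eq_zero] at ha
    exact ha.symm

variable [hM : IsAeGModuleAlgebra k A M G]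

namespace NormData

variable {H : Subgroup G} {ρ : G} {p e : ℕ} {m : M} {h : A →ₗ[k] M} [Fact p.Prime] [CharP k p]
  [H.Normal] {P : GradedAction k (fun n => imTheta k A M G n) (fun n => kerTheta k A M G n)}

theorem nonempty_iso (D : NormData k A M H ρ p e m h) [Finite H] (hH : (Nat.card H : k) ≠ 0)
    (hP : IsKerAction k A M G P) (i : ℕ) (hi : i + 2 ≤ p ^ e) :
    Nonempty (((cokerAction k A M G).quotient (isSubbimodule_cokerFiltration H ρ i)
      (isSubbimodule_cokerFiltration H ρ (i + 1))).Iso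
        (P.quotient (isSubbimodule_kerFiltration H ρ (p ^ e - 2 - i) hP)
          (isSubbimodule_kerFiltration H ρ (p ^ e - 1 - i) hP))) :=
  GradedAction.Iso.of_range_eq _ _ _ _ (D.torsionToCoker i) (fun n => D.torsionToKer i n hi)
    (fun n => D.range_torsionToCoker hH i n) (fun n => D.range_torsionToKer i n hi)
    (fun n w => D.torsionToCoker_mem_iff hH i n hi w) (D.exists_torsion_left hP i hi)
    (D.exists_torsion_right hP i hi)

/-- If a step of the filtration of `Y` is trivial, so is the corresponding step for `X`. -/
theorem kerFiltration_le_of_cokerFiltration_le (D : NormData k A M H ρ p e m h) [Finite H]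
    (hH : (Nat.card H : k) ≠ 0) {i n : ℕ} (hi : i + 2 ≤ p ^ e)
    (hY : cokerFiltration k A M H ρ i n ≤ cokerFiltration k A M H ρ (i + 1) n) :
    kerFiltration k A M H ρ (p ^ e - 2 - i) n ≤ kerFiltration k A M H ρ (p ^ e - 1 - i) n := by
  rw [← D.range_torsionToKer i n hi]
  rintro _ ⟨w, rfl⟩
  refine (D.torsionToCoker_mem_iff hH i n hi w).1 (hY ?_)
  rw [← D.range_torsionToCoker hH]
  exact ⟨w, rfl⟩

end NormData

theorem cokerFiltration_eq_top {H : Subgroup G} {ρ : G} {i : ℕ}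
    (hΔ : ∀ n, (invHH k A M G H n).map (DeltaHH k A M G ρ n ^ i) = invHH k A M G ⊤ n) (n : ℕ) :
    cokerFiltration k A M H ρ i n = ⊤ := by
  rw [eq_top_iff, ← cokerFiltration_zero H ρ n]
  refine Submodule.map_mono ?_
  rw [hΔ]
  exact fun y _ => y.2

/-- By hypothesis `Δ^i HH^H` is `G`-invariant, so one more `Δ` annihilates it. -/
theorem cokerFiltration_succ_eq_bot {H : Subgroup G} {ρ : G} {i : ℕ}
    (hΔ : ∀ n, (invHH k A M G H n).map (DeltaHH k A M G ρ n ^ i) = invHH k A M G ⊤ n) (n : ℕ) :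
    cokerFiltration k A M H ρ (i + 1) n = ⊥ := by
  rw [eq_bot_iff]
  rintro _ ⟨y, ⟨x, hx, hxy⟩, rfl⟩
  have hinv : (DeltaHH k A M G ρ n ^ i) x ∈ invHH k A M G ⊤ n := hΔ n ▸ ⟨x, hx, rfl⟩
  have hy : y = 0 := Subtype.ext (by
    rw [← Submodule.subtype_apply, ← hxy, pow_succ', Module.End.mul_apply]
    exact sub_eq_zero.2 (hinv ρ trivial).symm)
  rw [hy, map_zero]
  exact Submodule.zero_mem _

namespace NormData

variable {H : Subgroup G} {ρ : G} {p e : ℕ} {m : M} {h : A →ₗ[k] M} [Fact p.Prime] [CharP k p]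
  [H.Normal] {P : GradedAction k (fun n => imTheta k A M G n) (fun n => kerTheta k A M G n)}

/-- Below `i` all steps of `Y` are trivial, since `Y_i = Y`. Hence so are the corresponding steps of
`X`, which run upwards from `X_{q-1} = 0` to `X_{q-1-i}`. -/
theorem kerFiltration_eq_bot (D : NormData k A M H ρ p e m h) [Finite H]
    (hH : (Nat.card H : k) ≠ 0) {i : ℕ} (hi : i ≤ p ^ e - 1)
    (hΔ : ∀ n, (invHH k A M G H n).map (DeltaHH k A M G ρ n ^ i) = invHH k A M G ⊤ n) (n : ℕ) :
    kerFiltration k A M H ρ (p ^ e - 1 - i) n = ⊥ := by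
  have key : ∀ j, j ≤ i → kerFiltration k A M H ρ (p ^ e - 1 - j) n = ⊥ := by
    intro j
    induction j with
    | zero => exact fun _ => D.kerFiltration_last n
    | succ j ih =>
      intro hj
      have hanti : Antitone fun j => cokerFiltration k A M H ρ j n :=
        antitone_nat_of_succ_le fun j => cokerFiltration_succ_le H ρ j n
      have htop : cokerFiltration k A M H ρ (j + 1) n = ⊤ :=
        top_le_iff.1 ((cokerFiltration_eq_top hΔ n).symm.le.trans (hanti hj))
      rw [← le_bot_iff, ← ih (by omega), show p ^ e - 1 - (j + 1) = p ^ e - 2 - j by omega]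
      exact D.kerFiltration_le_of_cokerFiltration_le hH (by omega) (htop ▸ le_top)
  exact key i le_rfl

/-- Dually, `Y_{i+1} = 0` makes the steps of `X` trivial from `X_0 = X` down to `X_{q-2-i}`. For `i
= q - 1` the truncated index is `0` and nothing is claimed beyond `X_0 = X`. -/
theorem kerFiltration_eq_top (D : NormData k A M H ρ p e m h) [Finite H]
    (hH : (Nat.card H : k) ≠ 0) {i : ℕ}
    (hΔ : ∀ n, (invHH k A M G H n).map (DeltaHH k A M G ρ n ^ i) = invHH k A M G ⊤ n) (n : ℕ) :
    kerFiltration k A M H ρ (p ^ e - 2 - i) n = ⊤ := by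
  have key : ∀ l, l ≤ p ^ e - 2 - i → kerFiltration k A M H ρ l n = ⊤ := by
    intro l
    induction l with
    | zero => exact fun _ => kerFiltration_zero hH ρ n
    | succ l ih =>
      intro hl
      have hanti : Antitone fun j => cokerFiltration k A M H ρ j n :=
        antitone_nat_of_succ_le fun j => cokerFiltration_succ_le H ρ j n
      have hbot : cokerFiltration k A M H ρ (p ^ e - 2 - l) n = ⊥ :=
        le_bot_iff.1 ((hanti (show i + 1 ≤ p ^ e - 2 - l by omega)).trans
          (cokerFiltration_succ_eq_bot hΔ n).le)
      have h := D.kerFiltration_le_of_cokerFiltration_le hH (i := p ^ e - 2 - l) (n := n) (by omega)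
        (hbot ▸ bot_le)
      rw [show p ^ e - 2 - (p ^ e - 2 - l) = l by omega,
        show p ^ e - 1 - (p ^ e - 2 - l) = l + 1 by omega, ih (by omega)] at h
      exact top_le_iff.1 h
  exact key _ le_rfl

theorem nonempty_kerAction_iso (D : NormData k A M H ρ p e m h) [Finite H]
    (hH : (Nat.card H : k) ≠ 0) (hP : IsKerAction k A M G P) {i : ℕ} (hi : i ≤ p ^ e - 1)
    (hΔ : ∀ n, (invHH k A M G H n).map (DeltaHH k A M G ρ n ^ i) = invHH k A M G ⊤ n) :
    Nonempty (P.Iso (cokerAction k A M G)) := by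
  -- In the first case `i = q - 1`, there is no step for the comparison maps to use, and both
  -- bimodules vanish: `X = X_0 = 0` and `Y = Y_{q-1} = 0`.
  rcases Nat.lt_or_ge (p ^ e) (i + 2) with hi' | hi'
  · have hX : ∀ n, Subsingleton (kerTheta k A M G n) := fun n => by
      rw [← Submodule.subsingleton_iff k, ← subsingleton_iff_bot_eq_top,
        ← kerFiltration_zero hH ρ n, ← D.kerFiltration_eq_bot hH hi hΔ n,
        show p ^ e - 1 - i = 0 by omega]
    have hY : ∀ n, Subsingleton (cokerTheta k A M G n) := fun n => by
      rw [← Submodule.subsingleton_iff k, ← subsingleton_iff_bot_eq_top,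
        ← cokerFiltration_eq_top hΔ n, ← D.cokerFiltration_last hH n,
        show p ^ e - 1 = i by omega]
    exact GradedAction.Iso.of_ker_eq (fun _ => LinearMap.id) (fun _ => 0)
      (fun n => Function.surjective_id) (fun n y => ⟨0, (hY n).elim _ _⟩)
      (fun n z => iff_of_true ((hX n).elim _ _) rfl)
      (fun m n b z => ⟨0, (hX _).elim _ _, (hY _).elim _ _⟩)
      (fun m n b z => ⟨0, (hX _).elim _ _, (hY _).elim _ _⟩)
  -- Here the single step at `i` is everything: both maps from `Z_i` are onto the whole bimodules,
  -- and the two smaller terms are `0`, so the kernels agree.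
  · refine GradedAction.Iso.of_ker_eq (Z := fun n => deltaTorsionCocycles k A M H ρ i n)
      (fun n => D.torsionToKer i n hi') (D.torsionToCoker i)
      (fun n => ?_) (fun n => ?_) (fun n w => ?_) (fun m n b w => ?_) (fun m n b w => ?_)
    · rw [← LinearMap.range_eq_top, D.range_torsionToKer, D.kerFiltration_eq_top hH hΔ]
    · rw [← LinearMap.range_eq_top, D.range_torsionToCoker hH, cokerFiltration_eq_top hΔ]
    · rw [← Submodule.mem_bot k, ← Submodule.mem_bot k, ← cokerFiltration_succ_eq_bot hΔ n,
        D.torsionToCoker_mem_iff hH i n hi', D.kerFiltration_eq_bot hH hi hΔ]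
    · obtain ⟨w', h₁, h₂⟩ := D.exists_torsion_left hP i hi' m n b w
      exact ⟨w', h₂, h₁⟩
    · obtain ⟨w', h₁, h₂⟩ := D.exists_torsion_right hP i hi' m n b w
      exact ⟨w', h₂, h₁⟩

end NormData

end Main

end HochG

open HochG in
theorem mainTheorem3 {k A M G : Type*} [Field k] [Ring A] [Algebra k A] [Ring M] [Algebra k M]
    [Module A M] [Module Aᵐᵒᵖ M] [SMulCommClass A Aᵐᵒᵖ M]
    [IsScalarTower k A M] [IsScalarTower k Aᵐᵒᵖ M]
    [Group G] [MulSemiringAction G A] [SMulCommClass G k A]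
    [MulSemiringAction G M] [SMulCommClass G k M] [IsAeGModuleAlgebra k A M G]
    (p : ℕ) [Fact p.Prime] [CharP k p] (q e : ℕ) (hq : q = p ^ e)
    (H : Subgroup G) [H.Normal] [Finite H] (hH : ¬ p ∣ Nat.card H)
    (hGH : Nat.card (G ⧸ H) = q)
    (ρ : G) (hρ : ∀ x : G ⧸ H, x ∈ Subgroup.zpowers (ρ : G ⧸ H))
    (m : M) (h : A →ₗ[k] M) (hdeg : IsDegenerated H ρ q m h) :
    ∃ XAct : GradedAction k (fun n => imTheta k A M G n) (fun n => kerTheta k A M G n),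
    IsKerAction k A M G XAct ∧
    ∃ (X : ℕ → ∀ n, Submodule k (kerTheta k A M G n))
      (Y : ℕ → ∀ n, Submodule k (cokerTheta k A M G n))
      (hX : ∀ i, XAct.IsSubbimodule (X i))
      (hY : ∀ i, (cokerAction k A M G).IsSubbimodule (Y i)),
    (∀ i n, X (i + 1) n ≤ X i n) ∧ (∀ n, X 0 n = ⊤) ∧ (∀ n, X (q - 1) n = ⊥) ∧
    (∀ i n, Y (i + 1) n ≤ Y i n) ∧ (∀ n, Y 0 n = ⊤) ∧ (∀ n, Y (q - 1) n = ⊥) ∧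
    (∀ i, i + 2 ≤ q →
      Nonempty (((cokerAction k A M G).quotient (hY i) (hY (i + 1))).Iso
        (XAct.quotient (hX (q - 2 - i)) (hX (q - 1 - i))))) ∧
    (∀ i, i ≤ q - 1 →
      (∀ n, (invHH k A M G H n).map (DeltaHH k A M G ρ n ^ i) = invHH k A M G ⊤ n) →
      (∀ n, X (q - 1 - i) n = ⊥ ∧ Y (i + 1) n = ⊥ ∧ X (q - 2 - i) n = ⊤ ∧ Y i n = ⊤) ∧
      Nonempty (XAct.Iso (cokerAction k A M G))) := by
  subst hq
  have hH' : (Nat.card H : k) ≠ 0 := fun h0 => hH ((CharP.cast_eq_zero_iff k p _).1 h0)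
  have D := hdeg.normData hGH hρ
  obtain ⟨P, hP⟩ := exists_isKerAction k A M G (D.cupUp_kerTheta hH')
  exact ⟨P, hP, kerFiltration k A M H ρ, cokerFiltration k A M H ρ,
    fun l => isSubbimodule_kerFiltration H ρ l hP, fun i => isSubbimodule_cokerFiltration H ρ i,
    kerFiltration_succ_le H ρ, kerFiltration_zero hH' ρ, D.kerFiltration_last,
    cokerFiltration_succ_le H ρ, cokerFiltration_zero H ρ, D.cokerFiltration_last hH',
    D.nonempty_iso hH' hP, fun i hi hΔ =>
      ⟨fun n => ⟨D.kerFiltration_eq_bot hH' hi hΔ n, cokerFiltration_succ_eq_bot hΔ n,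
        D.kerFiltration_eq_top hH' hΔ n, cokerFiltration_eq_top hΔ n⟩,
      D.nonempty_kerAction_iso hH' hP hi hΔ⟩⟩
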